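/- **Setting.** A *Young tower* is a probability space $(X,m)$ with a partition $(B_{i,j})_{i\in I,\,0\le j<\phi_i}$ of $X$ into measurable sets of positive measure, where $I$ is countable and $\phi_i\ge 1$ are integers, and a measurable, $m$-preserving map $T:X\to X$ such that: 1. for $0\le j<\phi_i-1$, $T$ is a measure preserving isomorphism from $B_{i,j}$ onto $B_{i,j+1}$, and $T$ is an isomorphism from $B_{i,\phi_i-1}$ onto $B:=\bigcup_{k\in I}B_{k,0}$ (isomorphism: bijection, measurable and nonsingular in both directions); 2. writing $\phi=\phi_i$ on $B_{i,0}$, $T_B=T^{\phi}:B\to B$, and $s(x,y)=\inf\{n\ge 0 : T_B^n x\in B_{i,0},\ T_B^n y\in B_{j,0}\text{ for some } i\ne j\}\in\mathbb N\cup\{\infty\}$ for $x,y\in B$, the inverse $g_m>0$ of the jacobian of $T_B$ satisfies, for some $C>0$ and $0<\beta<1$, $|\log g_m(x)-\log g_m(y)|\le C\beta^{s(x,y)}$ for all $i$ and all $x,y\in B_{i,0}$; 3. the partition $\bigvee_{n\ge 0}T^{-n}((B_{i,j}))$ separates the points of $X$, and generates the $\sigma$-algebra modulo $m$-null sets (the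 latter is automatic if $(X,m)$ is a standard probability space). Extend $s$ to $X$ by $s(x,y)=0$ if $x,y$ lie in different sets $B_{i,j}$, and $s(x,y)=s(x',y')+1$ otherwise, where $x',y'$ are the next iterates of $x,y$ in $B$. For $0<\tau<1$ (with $\tau^\infty=0$), $C_\tau(X)$ is the set of $f:X\to\mathbb R$ such that, for some $C>0$, $|f(x)-f(y)|\le C\tau^{s(x,y)}$ for all $x,y\in X$. Similarly, $C_\nu(B)$ is the space of functions $u:B\to\mathbb C$ such that, for some $C>0$, $|u(x)-u(y)|\le C\nu^{s(x,y)}$ for all $x,y\in B$. Let $X$ be a Young tower with $\gcd(\phi_i)=1$, let $0<\tau<1$ and $f\in C_\tau(X)$, and let $\nu=\tau^\eta$ with $0<\eta<1/2$. Put $S_nf=\sum_{k=0}^{n-1}f\circ T^k$. For $t\in\mathbb R$, $z\in\mathbb C$ with $|z|\le 1$, $u\in C_\nu(B)$ and $x\in B$, let $$R_n(t)u(x)=\sum_{\substack{y\in B,\ T^ny=x\\ Ty,\dots,T^{n-1}y\notin B}} g_m(y)\,e^{itS_nf(y)}u(y)\quad(n\ge 1),\qquad R(z,t)u=\sum_{n\ge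 1}z^nR_n(t)u .$$ (These series converge absolutely; by definition, $1$ is an eigenvalue of $R(z,t)$ on $C_\nu(B)$ if $R(z,t)u=u$ for some nonzero $u\in C_\nu(B)$.) For $\lambda\in S^1$, say that $e^{itf}$ is *cohomologous* to $\lambda$ if there is a measurable $\omega:X\to S^1$ with $e^{itf}=\lambda\,\dfrac{\omega\circ T}{\omega}$ $m$-almost everywhere. **Statement.** (a) For all $t\in\mathbb R$ and $z\in S^1$: $e^{itf}$ is cohomologous to $z^{-1}$ if and only if $1$ is an eigenvalue of $R(z,t)$ on $C_\nu(B)$. (b) The set $\mathfrak A=\{t\in\mathbb R : e^{itf}\text{ is cohomologous to a constant in }S^1\}$ is a closed subgroup of $\mathbb R$. For every $t\in\mathfrak A$ there is a unique $z(t)\in S^1$ such that $e^{itf}$ is cohomologous to $z(t)$, and $t\mapsto z(t)$ is a continuous group homomorphism from $\mathfrak A$ to $S^1$. -/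

import Mathlib

open MeasureTheory

noncomputable section

/-- The data of a tower map: a map `T` of `X`, a partition of `X` into cells `B i j` with `i : ι`
and `j < ret i` (the cell of `x` is recorded by its column `idx x` and its level `level x`), and a
function `invJac`, of which only the values on the basis matter: it is the inverse `g_m` of the
jacobian of the return map to the basis (see `TowerMap.IsYoungTower`). -/
structure TowerMap (X : Type*) (ι : Type*) where
  T : X → X
  idx : X → ι
  level : X → ℕ
  ret : ι → ℕ
  invJac : X → ℝ

/-- `τ ^ s` for `s ∈ ℕ ∪ {∞}`, with `τ ^ ∞ = 0` (used for `0 < τ < 1`). -/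
def sepPow (τ : ℝ) (s : ℕ∞) : ℝ :=
  open Classical in if s = ⊤ then 0 else τ ^ s.toNat

/-- `u` is Hölder with parameter `τ` for the separation time `s`:
`‖u x - u y‖ ≤ C τ ^ s(x,y)` for all `x, y`. (Such a `u` is bounded.) -/
def IsHolderSep {Z E : Type*} [NormedAddCommGroup E] (s : Z → Z → ℕ∞) (τ : ℝ) (u : Z → E) : Prop :=
  ∃ C : ℝ, 0 < C ∧ ∀ x y : Z, ‖u x - u y‖ ≤ C * sepPow τ (s x y)

/-- `T` is an isomorphism (of measurable sets) from `A` onto `A'`; the measurability of `T` itself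
is required separately. -/
def IsMeasIso {X : Type*} [MeasurableSpace X] (T : X → X) (A A' : Set X) : Prop :=
  Set.BijOn T A A' ∧ ∀ E : Set X, E ⊆ A → MeasurableSet E → MeasurableSet (T '' E)

namespace TowerMap

variable {X ι : Type*}

/-- The cell `B i j` of the partition. -/
def cell (D : TowerMap X ι) (i : ι) (j : ℕ) : Set X := {x | D.idx x = i ∧ D.level x = j}

/-- The basis `B = ⋃ i, B i 0`. -/
def base (D : TowerMap X ι) : Set X := {x | D.level x = 0}

/-- The return map `T_B = T ^ φ` on the basis, where `φ = ret i` on `B i 0`. -/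
def baseMap (D : TowerMap X ι) (x : X) : X := D.T^[D.ret (D.idx x)] x

/-- The separation time of two points of the basis under the return map. -/
def baseSep (D : TowerMap X ι) (x y : X) : ℕ∞ :=
  sInf {s : ℕ∞ | ∃ n : ℕ, s = n ∧ ∃ i j : ι, i ≠ j ∧
    D.baseMap^[n] x ∈ D.cell i 0 ∧ D.baseMap^[n] y ∈ D.cell j 0}

/-- The next iterate of `x` in the basis (at a strictly positive time). -/
def nextBase (D : TowerMap X ι) (x : X) : X := D.T^[D.ret (D.idx x) - D.level x] x

/-- The separation time, extended to the whole tower. -/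
def sep (D : TowerMap X ι) (x y : X) : ℕ∞ :=
  open Classical in
  if D.idx x = D.idx y ∧ D.level x = D.level y then
    D.baseSep (D.nextBase x) (D.nextBase y) + 1 else 0

/-- `(X, m, T)` with the given partition is a Young tower, and `invJac` is, on the basis, the
inverse of the jacobian of the return map `T ^ φ`, in the version (unique everywhere, since all
cylinders have positive measure) for which the distortion bound holds. -/
structure IsYoungTower [MeasurableSpace X] (D : TowerMap X ι) (m : Measure X) : Prop where
  level_lt : ∀ x, D.level x < D.ret (D.idx x)
  ret_pos : ∀ i, 0 < D.ret i
  measurableSet_cell : ∀ i j, MeasurableSet (D.cell i j)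
  cell_pos : ∀ i j, j < D.ret i → 0 < m (D.cell i j)
  measurable_T : Measurable D.T
  /-- `T` is a measure preserving isomorphism between `B i j` and `B i (j+1)`. -/
  iso_level : ∀ i j, j + 1 < D.ret i → IsMeasIso D.T (D.cell i j) (D.cell i (j + 1))
  measure_level : ∀ i j, j + 1 < D.ret i → ∀ A ⊆ D.cell i j, MeasurableSet A →
    m (D.T '' A) = m A
  /-- `T` is an isomorphism between the top of each column and the basis. -/
  iso_top : ∀ i, IsMeasIso D.T (D.cell i (D.ret i - 1)) D.base
  invJac_pos : ∀ x ∈ D.base, 0 < D.invJac x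
  /-- The jacobian of `T ^ φ` on `B i 0` is `1 / invJac`; in particular the isomorphisms are
  nonsingular in both directions. -/
  jacobian : ∀ i, ∀ A ⊆ D.cell i 0, MeasurableSet A →
    m (D.T^[D.ret i] '' A) = ∫⁻ x in A, ENNReal.ofReal (D.invJac x)⁻¹ ∂m
  distortion : ∃ β : ℝ, 0 < β ∧ β < 1 ∧ ∃ C : ℝ, 0 < C ∧ ∀ i, ∀ x ∈ D.cell i 0, ∀ y ∈ D.cell i 0,
    |Real.log (D.invJac x) - Real.log (D.invJac y)| ≤ C * sepPow β (D.baseSep x y)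
  preserves : MeasurePreserving D.T m m
  /-- The partition `⋁ T^{-n} (B i j)` separates the points. -/
  separates : ∀ x y, (∀ n : ℕ, D.idx (D.T^[n] x) = D.idx (D.T^[n] y) ∧
    D.level (D.T^[n] x) = D.level (D.T^[n] y)) → x = y
  /-- The cylinders generate the `σ`-algebra modulo null sets. On a standard probability space this
  is a consequence of the separation of points. -/
  generates : ∀ A : Set X, MeasurableSet A → ∃ A' : Set X,
    MeasurableSet[MeasurableSpace.generateFrom
      {S : Set X | ∃ (n : ℕ) (i : ι) (j : ℕ), S = D.T^[n] ⁻¹' D.cell i j}] A' ∧ A =ᵐ[m] A'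

/-- `gcd (φ_i) = 1`. -/
def IsMixing (D : TowerMap X ι) : Prop := ∀ d : ℕ, (∀ i, d ∣ D.ret i) → d = 1

/-- `f ∈ C_τ(X)`. -/
def HolderX (D : TowerMap X ι) (τ : ℝ) (f : X → ℝ) : Prop := IsHolderSep D.sep τ f

/-- `u ∈ C_ν(B)` (complex valued functions on the basis). -/
def HolderB (D : TowerMap X ι) (ν : ℝ) (u : D.base → ℂ) : Prop :=
  IsHolderSep (fun x y : D.base => D.baseSep x y) ν u

/-- The points of the basis whose first return to the basis occurs at time `n`, at `x`. -/
def firstReturn (D : TowerMap X ι) (n : ℕ) (x : D.base) : Set D.base :=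
  {y | 0 < n ∧ D.T^[n] y = x ∧ ∀ k, 0 < k → k < n → D.T^[k] y ∉ D.base}

/-- The weight `e^{i t S_n f(y)} g_m^{(n)}(y) u(y)`. On `firstReturn n x` the inverse jacobian
`g_m^{(n)}` of `T ^ n` is `invJac`. -/
def weight (D : TowerMap X ι) (f : X → ℝ) (t : ℝ) (u : D.base → ℂ) (n : ℕ) (y : D.base) : ℂ :=
  (D.invJac y : ℂ) * (Complex.exp (Complex.I * t * (birkhoffSum D.T f n y : ℝ)) * u y)

/-- The first return operator `R_n(t)`. -/
def opRn (D : TowerMap X ι) (f : X → ℝ) (n : ℕ) (t : ℝ) (u : D.base → ℂ) (x : D.base) : ℂ :=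
  ∑' y : D.firstReturn n x, D.weight f t u n y

/-- The operator `R(z,t) = ∑ z ^ n R_n(t)`. Both this series and the one in `opRn` converge
absolutely for `|z| ≤ 1` and bounded `u`, see `IsYoungTower.summable_opR`. -/
def opR (D : TowerMap X ι) (f : X → ℝ) (z : ℂ) (t : ℝ) (u : D.base → ℂ) (x : D.base) : ℂ :=
  ∑' n : ℕ, z ^ n * D.opRn f n t u x

/-- `1` is an eigenvalue of `R(z,t)` acting on `C_ν(B)`. -/
def HasEigenvalueOne (D : TowerMap X ι) (f : X → ℝ) (ν : ℝ) (z : ℂ) (t : ℝ) : Prop :=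
  ∃ u : D.base → ℂ, D.HolderB ν u ∧ u ≠ 0 ∧ D.opR f z t u = u

section Convergence

variable [MeasurableSpace X] {m : Measure X} {D : TowerMap X ι}

theorem sepPow_le_one {β : ℝ} (h0 : 0 < β) (h1 : β < 1) (s : ℕ∞) : sepPow β s ≤ 1 := by
  unfold sepPow
  split_ifs
  · exact zero_le_one
  · exact pow_le_one₀ h0.le h1.le

theorem IsYoungTower.bijOn_iterate (hD : D.IsYoungTower m) (i : ι) :
    ∀ j, j < D.ret i → Set.BijOn D.T^[j] (D.cell i 0) (D.cell i j) := by
  intro j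
  induction j with
  | zero => intro _; exact Set.bijOn_id _
  | succ j ih =>
    intro h
    rw [Function.iterate_succ']
    exact (hD.iso_level i j h).1.comp (ih (by omega))

theorem IsYoungTower.bijOn_return (hD : D.IsYoungTower m) (i : ι) :
    Set.BijOn D.T^[D.ret i] (D.cell i 0) D.base := by
  have h := hD.ret_pos i
  have h2 := (hD.iso_top i).1.comp (hD.bijOn_iterate i (D.ret i - 1) (by omega))
  rw [← Function.iterate_succ', Nat.succ_eq_add_one, Nat.sub_add_cancel h] at h2
  exact h2

theorem IsYoungTower.eq_ret (hD : D.IsYoungTower m) {n : ℕ} {x y : D.base}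
    (hy : y ∈ D.firstReturn n x) : n = D.ret (D.idx y) := by
  obtain ⟨h0, hx, hk⟩ := hy
  have hc : (y : X) ∈ D.cell (D.idx y) 0 := ⟨rfl, y.2⟩
  rcases lt_trichotomy n (D.ret (D.idx y)) with h | h | h
  · have h1 := ((hD.bijOn_iterate _ n h).mapsTo hc).2
    have h2 : D.level (D.T^[n] y) = 0 := by rw [hx]; exact x.2
    omega
  · exact h
  · exact absurd ((hD.bijOn_return _).mapsTo hc) (hk _ (hD.ret_pos _) h)

theorem IsYoungTower.invJac_le [IsProbabilityMeasure m] (hD : D.IsYoungTower m) :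
    ∃ K : ℝ, 0 ≤ K ∧ ∀ i, ∀ y ∈ D.cell i 0, D.invJac y ≤ K * m.real (D.cell i 0) := by
  obtain ⟨β, hβ0, hβ1, C, hC, hdist⟩ := hD.distortion
  rcases isEmpty_or_nonempty ι with hι | ⟨⟨i0⟩⟩
  · exact ⟨0, le_rfl, fun i => (hι.false i).elim⟩
  have hB : 0 < m.real D.base := by
    have h1 : D.cell i0 0 ⊆ D.base := fun x hx => hx.2
    have h2 : 0 < m D.base := lt_of_lt_of_le (hD.cell_pos i0 0 (hD.ret_pos i0)) (measure_mono h1)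
    exact ENNReal.toReal_pos h2.ne' (measure_ne_top _ _)
  refine ⟨Real.exp C / m.real D.base, by positivity, fun i y hy => ?_⟩
  have hgy := hD.invJac_pos y hy.2
  have hle : ∀ x ∈ D.cell i 0, (D.invJac x)⁻¹ ≤ Real.exp C / D.invJac y := by
    intro x hx
    have hgx := hD.invJac_pos x hx.2
    have h1 : |Real.log (D.invJac y) - Real.log (D.invJac x)| ≤ C :=
      (hdist i y hy x hx).trans (mul_le_of_le_one_right hC.le (sepPow_le_one hβ0 hβ1 _))
    have h2 : Real.log (D.invJac y / D.invJac x) ≤ C := by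
      rw [Real.log_div hgy.ne' hgx.ne']
      exact (le_abs_self _).trans h1
    have h3 := (Real.log_le_iff_le_exp (div_pos hgy hgx)).1 h2
    rw [le_div_iff₀ hgy, mul_comm, ← div_eq_mul_inv]
    exact h3
  have hmB : m D.base ≤ ENNReal.ofReal (Real.exp C / D.invJac y) * m (D.cell i 0) := by
    have h1 := hD.jacobian i (D.cell i 0) le_rfl (hD.measurableSet_cell i 0)
    rw [(hD.bijOn_return i).image_eq] at h1
    rw [h1, ← setLIntegral_const]
    exact setLIntegral_mono' (hD.measurableSet_cell i 0)
      (fun x hx => ENNReal.ofReal_le_ofReal (hle x hx))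
  have hreal : m.real D.base ≤ Real.exp C / D.invJac y * m.real (D.cell i 0) := by
    have h1 := ENNReal.toReal_mono (by finiteness) hmB
    rwa [ENNReal.toReal_mul, ENNReal.toReal_ofReal (by positivity)] at h1
  rw [div_mul_eq_mul_div, le_div_iff₀ hgy] at hreal
  rw [div_mul_eq_mul_div, le_div_iff₀ hB]
  linarith

theorem IsYoungTower.summable_cell [IsProbabilityMeasure m] (hD : D.IsYoungTower m) :
    Summable fun i => m.real (D.cell i 0) := by
  refine ENNReal.summable_toReal (ne_top_of_le_ne_top (measure_ne_top m Set.univ) ?_)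
  refine tsum_meas_le_meas_iUnion_of_disjoint m (fun i => hD.measurableSet_cell i 0) ?_ |>.trans
    (measure_mono (Set.subset_univ _))
  intro i j hij
  refine Set.disjoint_left.2 fun x hx hy => hij (hx.1.symm.trans hy.1)

/-- The series defining `R_n(t) u` and `R(z,t) u` converge absolutely for bounded `u`, in particular
for `u ∈ C_ν(B)`. -/
theorem IsYoungTower.summable_opR [IsProbabilityMeasure m] (hD : D.IsYoungTower m)
    (f : X → ℝ) (t : ℝ) {z : ℂ} (hz : ‖z‖ ≤ 1) {u : D.base → ℂ} {M : ℝ} (hu : ∀ x, ‖u x‖ ≤ M)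
    (x : D.base) :
    (∀ n, Summable fun y : D.firstReturn n x => ‖D.weight f t u n y‖) ∧
      Summable fun n : ℕ => ‖z ^ n * D.opRn f n t u x‖ := by
  obtain ⟨K, hK, hg⟩ := hD.invJac_le
  have hM : 0 ≤ M := (norm_nonneg _).trans (hu x)
  have hinj : Function.Injective
      (fun p : (n : ℕ) × D.firstReturn n x => D.idx (p.2 : D.base)) := by
    rintro ⟨n, y, hy⟩ ⟨n', y', hy'⟩ h
    simp only at h
    have e1 := hD.eq_ret hy
    have e2 := hD.eq_ret hy'
    have hn : n = n' := by rw [e1, e2, h]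
    subst hn
    have hyy : y = y' := by
      apply Subtype.ext
      refine (hD.bijOn_return (D.idx y)).injOn ⟨rfl, y.2⟩ ⟨h.symm, y'.2⟩ ?_
      rw [← e1, hy.2.1, hy'.2.1]
    subst hyy
    rfl
  have hbound : ∀ p : (n : ℕ) × D.firstReturn n x,
      ‖D.weight f t u p.1 p.2‖ ≤ K * m.real (D.cell (D.idx (p.2 : D.base)) 0) * M := by
    rintro ⟨n, y, hy⟩
    have e : ‖Complex.exp (Complex.I * t * (birkhoffSum D.T f n y : ℝ))‖ = 1 := by
      rw [mul_assoc, mul_comm, ← Complex.ofReal_mul]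
      exact Complex.norm_exp_ofReal_mul_I _
    have hp := hD.invJac_pos y y.2
    simp only [weight, norm_mul, e, one_mul, Complex.norm_real, Real.norm_eq_abs, abs_of_pos hp]
    exact mul_le_mul (hg _ y ⟨rfl, y.2⟩) (hu y) (norm_nonneg _) (by positivity)
  have hs : Summable fun p : (n : ℕ) × D.firstReturn n x => ‖D.weight f t u p.1 p.2‖ := by
    refine Summable.of_nonneg_of_le (fun _ => norm_nonneg _) hbound ?_
    exact ((hD.summable_cell.comp_injective hinj).mul_left K).mul_right M
  have h1 : ∀ n, Summable fun y : D.firstReturn n x => ‖D.weight f t u n y‖ :=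
    fun n => hs.sigma_factor n
  refine ⟨h1, Summable.of_nonneg_of_le (fun _ => norm_nonneg _) (fun n => ?_) hs.sigma⟩
  rw [norm_mul, norm_pow]
  calc ‖z‖ ^ n * ‖D.opRn f n t u x‖ ≤ 1 * ‖D.opRn f n t u x‖ := by
        gcongr
        exact pow_le_one₀ (norm_nonneg _) hz
    _ ≤ ∑' y : D.firstReturn n x, ‖D.weight f t u n y‖ := by
        rw [one_mul]
        exact norm_tsum_le_tsum_norm (h1 n)

end Convergence

end TowerMap

/-- `e^{itf}` is cohomologous to the constant `c ∈ S¹`: `e^{itf} = c · (ω ∘ T) / ω` almost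
everywhere, for some measurable `ω : X → S¹`. -/
def IsCohomologousTo {X : Type*} [MeasurableSpace X] (m : Measure X) (T : X → X) (f : X → ℝ)
    (t : ℝ) (c : Circle) : Prop :=
  ∃ ω : X → Circle, (Measurable fun x => (ω x : ℂ)) ∧ ∀ᵐ x ∂m, Circle.exp (t * f x) = c * (ω (T x) / ω x)

end

/-!
The return map `T_B` of a Young tower to its basis `B` is a Gibbs–Markov map all of whose branches
are onto `B`, and `R(z,t)` is its transfer operator twisted by the weight
`W = z ^ φ · e^{i t S_φ f}`, where `φ` is the return time (`opR_eq_transfer`). A function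
`ω : X → S¹` with `e^{itf} = z⁻¹ · (ω ∘ T) / ω` is the same thing as a function `u : B → S¹` with
`u ∘ T_B = W u`, namely its restriction to the basis. Everything is deduced from this equation on
the basis. The weight `W` is Hölder on the cells, with constants proportional to the return times;
these are unbounded, but integrable, because the columns have total mass one.

If `u ∘ T_B = W u` everywhere then `R(z,t) u = u`, since the transfer operator of `T_B` fixes the
constants. Conversely, if `R(z,t) u = u`, then `|u|` is dominated by its image under the positive
transfer operator, hence constant by a maximum principle (`eq_of_le_tsum_br`), and `u` is at each
point an average of numbers of the same modulus, which are therefore equal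
(`exists_solution_of_transfer_eq`).

If `u` is only measurable and solves the equation almost everywhere, it is still a fixed point of
`R(z,t)` almost everywhere. By martingale convergence it is a limit in `L¹` of functions of finitely
many symbols; applying enough iterates of `R(z,t)` to these gives functions which are uniformly
Hölder, by the one-step Lasota–Yorke estimate, and still converge to `u`. Hence `u` has a Hölder
version (`exists_holder_solution`). The exponent obtained in this way also involves the distortion
of `T_B`; iterating `u ∘ T_B = W u` along a single inverse branch shows that `u` is Hölder with
parameter `τ` and with a constant `A |t|` (`HolderFrom.of_eq_mul`).

The uniformity of this constant carries the second part. For `t = 0` it says that `u` is constant,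
so that `z ^ φ_i = 1` for all `i` and `z = 1`, as the return times have no common divisor; this is
the uniqueness of `z(t)`. For `t_k → t` the solutions have pointwise limits along ultrafilters, which
are again Hölder solutions (`isCohomologousTo_of_tendsto`); this gives both the closedness of the
subgroup and the continuity of `t ↦ z(t)`.
-/

noncomputable section

open Filter Topology

/-! ### Full-branch Gibbs–Markov maps -/

/-- A full-branch Gibbs–Markov map `F`: it preserves the measure and maps each cell `{idx = i}`
bijectively onto the whole space, with inverse branch `br i`, and `g` is the inverse of its jacobian,
which is expressed by the change of variables `lintegral_br`. The separation time is encoded by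
itineraries: two points separate at time `n` at the earliest if and only if the cells of `F^k x` and
`F^k y` agree for all `k < n`. The sequence `p` is a summable bound for `g` on the cells, and
`distortion` is the distortion bound for `g` itself instead of its logarithm. -/
structure GibbsMarkov {Z : Type*} (ι : Type*) [MeasurableSpace Z] (μ : Measure Z) where
  F : Z → Z
  idx : Z → ι
  br : ι → Z → Z
  g : Z → ℝ
  p : ι → ℝ
  β : ℝ
  C : ℝ
  F_br : ∀ i x, F (br i x) = x
  idx_br : ∀ i x, idx (br i x) = i
  br_F : ∀ x, br (idx x) (F x) = x
  g_pos : ∀ x, 0 < g x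
  g_le : ∀ x, g x ≤ p (idx x)
  summable_p : Summable p
  β_pos : 0 < β
  β_lt : β < 1
  C_pos : 0 < C
  distortion : ∀ n x y, (∀ k < n + 1, idx (F^[k] x) = idx (F^[k] y)) →
    |g x - g y| ≤ C * β ^ (n + 1) * g y
  measurable_g : Measurable g
  measurableSet_idx : ∀ i, MeasurableSet (idx ⁻¹' {i})
  measurable_br : ∀ i, Measurable (br i)
  preserves : MeasurePreserving F μ μ
  lintegral_br : ∀ i (h : Z → ENNReal), Measurable h →
    ∫⁻ x, ENNReal.ofReal (g (br i x)) * h (br i x) ∂μ = ∫⁻ x in idx ⁻¹' {i}, h x ∂μ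
  generates : ∀ A : Set Z, MeasurableSet A → ∃ A' : Set Z,
    MeasurableSet[MeasurableSpace.generateFrom
      {S : Set Z | ∃ (n : ℕ) (i : ι), S = F^[n] ⁻¹' (idx ⁻¹' {i})}] A' ∧ A =ᵐ[μ] A'

/-- A function which is constant up to `ε n` on the fibres of a countably valued measurable map
`q n`, where `ε n` tends to `0`, is measurable. -/
theorem measurable_of_countable_fibres {X E : Type*} [MeasurableSpace X] [PseudoMetricSpace E]
    [MeasurableSpace E] [BorelSpace E] {κ : ℕ → Type*} [∀ n, Countable (κ n)]
    (q : ∀ n, X → κ n) (hq : ∀ n k, MeasurableSet (q n ⁻¹' {k})) {f : X → E} {ε : ℕ → ℝ}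
    (hε : Tendsto ε atTop (𝓝 0)) (h : ∀ n x y, q n x = q n y → dist (f x) (f y) ≤ ε n) :
    Measurable f := by
  rcases isEmpty_or_nonempty X with hX | hX
  · exact measurable_of_empty f
  have hmeas : ∀ n, Measurable fun x => f (Function.invFun (q n) (q n x)) := by
    intro n
    let _ : MeasurableSpace (κ n) := ⊤
    have h1 : Measurable (q n) := measurable_to_countable' (hq n)
    exact (measurable_from_top (f := fun k => f (Function.invFun (q n) k))).comp h1
  refine measurable_of_tendsto_metrizable hmeas (tendsto_pi_nhds.2 fun x => ?_)
  rw [tendsto_iff_dist_tendsto_zero]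
  refine squeeze_zero (fun _ => dist_nonneg) (fun n => h n _ _ ?_) hε
  exact Function.invFun_eq ⟨x, rfl⟩

theorem measurableSet_itinerary {Z ι : Type*} [MeasurableSpace Z] {F : Z → Z} {idx : Z → ι}
    (hF : Measurable F) (hidx : ∀ i, MeasurableSet (idx ⁻¹' {i})) (n : ℕ) (w : Fin n → ι) :
    MeasurableSet ((fun x (k : Fin n) => idx (F^[k] x)) ⁻¹' {w}) := by
  have : (fun x (k : Fin n) => idx (F^[k] x)) ⁻¹' {w} =
      ⋂ k : Fin n, F^[k] ⁻¹' (idx ⁻¹' {w k}) := by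
    ext x
    simp [funext_iff]
  rw [this]
  exact MeasurableSet.iInter fun k => (hF.iterate k) (hidx (w k))

namespace GibbsMarkov

variable {Z ι : Type*} [MeasurableSpace Z] {μ : Measure Z} (S : GibbsMarkov ι μ)

/-- The orbits of `x` and `y` visit the same cells before time `n`. -/
def Agree (n : ℕ) (x y : Z) : Prop := ∀ k < n, S.idx (S.F^[k] x) = S.idx (S.F^[k] y)

variable {S}

theorem Agree.symm {n : ℕ} {x y : Z} (h : S.Agree n x y) : S.Agree n y x :=
  fun k hk => (h k hk).symm

theorem agree_succ {n : ℕ} {x y : Z} :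
    S.Agree (n + 1) x y ↔ S.idx x = S.idx y ∧ S.Agree n (S.F x) (S.F y) := by
  constructor
  · exact fun h => ⟨h 0 (by omega), fun k hk => h (k + 1) (by omega)⟩
  · rintro ⟨h0, h⟩ k hk
    cases k with
    | zero => exact h0
    | succ k => exact h k (by omega)

theorem agree_br {n : ℕ} {i : ι} {x y : Z} :
    S.Agree (n + 1) (S.br i x) (S.br i y) ↔ S.Agree n x y := by
  rw [agree_succ, S.F_br, S.F_br, S.idx_br, S.idx_br]
  simp

theorem measurableSet_agree_itinerary (n : ℕ) (w : Fin n → ι) :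
    MeasurableSet ((fun x (k : Fin n) => S.idx (S.F^[k] x)) ⁻¹' {w}) :=
  measurableSet_itinerary S.preserves.measurable S.measurableSet_idx n w

theorem agree_iff_itinerary_eq {n : ℕ} {x y : Z} :
    (fun k : Fin n => S.idx (S.F^[k] x)) = (fun k : Fin n => S.idx (S.F^[k] y)) ↔
      S.Agree n x y := by
  simp only [funext_iff]
  exact ⟨fun h k hk => h ⟨k, hk⟩, fun h k => h k k.2⟩

/-- Hölder continuity for the separation time, for points which agree up to time `k` at least. -/
def HolderFrom {E : Type*} [Dist E] (S : GibbsMarkov ι μ) (k : ℕ) (L ρ : ℝ) (v : Z → E) : Prop :=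
  ∀ n, k ≤ n → ∀ x y, S.Agree n x y → dist (v x) (v y) ≤ L * ρ ^ n

theorem HolderFrom.measurable [Countable ι] {E : Type*} [PseudoMetricSpace E]
    [MeasurableSpace E] [BorelSpace E] {k : ℕ} {L ρ : ℝ} (h0 : 0 ≤ ρ) (h1 : ρ < 1) {v : Z → E}
    (hv : S.HolderFrom k L ρ v) : Measurable v := by
  refine measurable_of_countable_fibres (κ := fun n => Fin (n + k) → ι)
    (fun n x j => S.idx (S.F^[j] x)) (fun n w => measurableSet_agree_itinerary _ w)
    (ε := fun n => L * ρ ^ (n + k)) ?_ ?_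
  · have := (tendsto_pow_atTop_nhds_zero_of_lt_one h0 h1).comp (tendsto_add_atTop_nat k)
    simpa using this.const_mul L
  · exact fun n x y hxy => hv _ (by omega) x y (agree_iff_itinerary_eq.1 hxy)

theorem iUnion_cell : ⋃ i, S.idx ⁻¹' {i} = Set.univ := by
  ext x
  simp

/-- The transfer operator of `F` preserves the integral. -/
theorem lintegral_tsum_br [Countable ι] {h : Z → ENNReal} (hh : Measurable h) :
    ∫⁻ x, ∑' i, ENNReal.ofReal (S.g (S.br i x)) * h (S.br i x) ∂μ = ∫⁻ x, h x ∂μ := by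
  rw [lintegral_tsum]
  · simp_rw [S.lintegral_br _ h hh]
    rw [← lintegral_iUnion S.measurableSet_idx, iUnion_cell, setLIntegral_univ]
    intro i j hij
    refine Set.disjoint_left.2 fun x hx hy => hij ?_
    simp only [Set.mem_preimage, Set.mem_singleton_iff] at hx hy
    rw [← hx, hy]
  · intro i
    exact ((S.measurable_g.comp (S.measurable_br i)).ennreal_ofReal.mul
      (hh.comp (S.measurable_br i))).aemeasurable

theorem cylinder_pos [NeZero μ] (n : ℕ) : ∀ x, 0 < μ {y | S.Agree n x y} := by
  induction n with
  | zero =>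
    intro x
    have : {y | S.Agree 0 x y} = Set.univ := by
      ext y
      simp [Agree]
    rw [this]
    exact Measure.measure_univ_pos.2 (NeZero.ne μ)
  | succ n ih =>
    intro x
    set A := {y | S.Agree n (S.F x) y}
    have hA : MeasurableSet A := by
      have := measurableSet_agree_itinerary (S := S) n (fun k => S.idx (S.F^[k] (S.F x)))
      convert this using 1
      ext y
      exact (agree_iff_itinerary_eq.trans ⟨Agree.symm, Agree.symm⟩).symm
    have hFA : MeasurableSet (S.F ⁻¹' A) := S.preserves.measurable hA
    have hset : {y | S.Agree (n + 1) x y} = S.F ⁻¹' A ∩ S.idx ⁻¹' {S.idx x} := by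
      ext y
      simp only [Set.mem_ofPred_eq, agree_succ, A, Set.mem_inter_iff, Set.mem_preimage,
        Set.mem_singleton_iff]
      tauto
    have h := S.lintegral_br (S.idx x) ((S.F ⁻¹' A).indicator 1) (measurable_one.indicator hFA)
    rw [lintegral_indicator_one hFA, Measure.restrict_apply hFA, ← hset] at h
    rw [← h, pos_iff_ne_zero]
    intro h0
    have hm : Measurable fun y => ENNReal.ofReal (S.g (S.br (S.idx x) y)) *
        (S.F ⁻¹' A).indicator (1 : Z → ENNReal) (S.br (S.idx x) y) :=
      (S.measurable_g.comp (S.measurable_br _)).ennreal_ofReal.mul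
        ((measurable_one.indicator hFA).comp (S.measurable_br _))
    rw [lintegral_eq_zero_iff hm] at h0
    have h2 : μ A = 0 := by
      refine measure_mono_null (fun y hy => ?_) h0
      simp [S.F_br, S.g_pos, hy]
    exact (ih (S.F x)).ne' h2

/-- A property which holds almost everywhere holds on a dense set for the separation time. -/
theorem exists_agree_of_ae [NeZero μ] {P : Z → Prop} (hP : ∀ᵐ x ∂μ, P x) (n : ℕ) (x : Z) :
    ∃ y, S.Agree n x y ∧ P y := by
  by_contra! h
  refine (cylinder_pos (S := S) n x).ne' (measure_mono_null (fun y hy => ?_) hP)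
  exact h y hy

variable (S) in
theorem summable_g (x : Z) : Summable fun i => S.g (S.br i x) :=
  Summable.of_nonneg_of_le (fun i => (S.g_pos _).le)
    (fun i => (S.g_le _).trans_eq (by rw [S.idx_br])) S.summable_p

variable (S) in
theorem g_br_le (i : ι) (x : Z) : S.g (S.br i x) ≤ S.p i :=
  (S.g_le _).trans_eq (by rw [S.idx_br])

variable (S) in
theorem p_nonneg [Nonempty Z] (i : ι) : 0 ≤ S.p i :=
  (S.g_pos _).le.trans (S.g_br_le i (Classical.arbitrary Z))

theorem abs_g_br_sub_le {n : ℕ} {x y : Z} (h : S.Agree n x y) (i : ι) :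
    |S.g (S.br i x) - S.g (S.br i y)| ≤ S.C * S.β ^ n * S.p i := by
  have h1 := S.distortion n _ _ (agree_br (i := i) |>.2 h)
  have hC := S.C_pos
  have hβ := S.β_pos
  refine h1.trans ?_
  refine mul_le_mul (mul_le_mul_of_nonneg_left ?_ hC.le) (S.g_br_le i y) (S.g_pos _).le
    (by positivity)
  exact pow_le_pow_of_le_one hβ.le S.β_lt.le (Nat.le_succ n)

variable (S) in
/-- Since `F` preserves the measure, its transfer operator fixes the constants; the identity holds
at every point by continuity. -/
theorem tsum_g_br [Countable ι] [IsFiniteMeasure μ] [NeZero μ] (x : Z) :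
    ∑' i, S.g (S.br i x) = 1 := by
  have hmeas : ∀ i, Measurable fun x => S.g (S.br i x) :=
    fun i => S.measurable_g.comp (S.measurable_br i)
  have hae : (fun x => ∑' i, ENNReal.ofReal (S.g (S.br i x))) =ᵐ[μ] fun _ => 1 := by
    refine ae_eq_of_forall_setLIntegral_eq_of_sigmaFinite
      (Measurable.tsum fun i => (hmeas i).ennreal_ofReal) measurable_const ?_
    intro A hA _
    have hFA : MeasurableSet (S.F ⁻¹' A) := S.preserves.measurable hA
    have h := lintegral_tsum_br (S := S) (h := (S.F ⁻¹' A).indicator 1)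
      (measurable_one.indicator hFA)
    rw [lintegral_indicator_one hFA, S.preserves.measure_preimage hA.nullMeasurableSet] at h
    rw [setLIntegral_const, one_mul, ← h, ← lintegral_indicator hA]
    congr 1
    ext x
    by_cases hx : x ∈ A
    · simp [hx, S.F_br, Set.indicator]
    · simp [hx, S.F_br, Set.indicator]
  have hae' : ∀ᵐ x ∂μ, ∑' i, S.g (S.br i x) = 1 := by
    filter_upwards [hae] with x hx
    rw [← ENNReal.ofReal_tsum_of_nonneg (fun i => (S.g_pos _).le) (S.summable_g x)] at hx
    simpa using hx
  have hlim : Tendsto (fun n => S.C * S.β ^ n * ∑' i, S.p i) atTop (𝓝 0) := by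
    have := tendsto_pow_atTop_nhds_zero_of_lt_one S.β_pos.le S.β_lt
    simpa using (this.const_mul S.C).mul_const (∑' i, S.p i)
  have hle : ∀ n, |∑' i, S.g (S.br i x) - 1| ≤ S.C * S.β ^ n * ∑' i, S.p i := by
    intro n
    obtain ⟨y, hy, h1⟩ := exists_agree_of_ae hae' n x
    rw [← h1, ← (S.summable_g x).tsum_sub (S.summable_g y)]
    exact tsum_of_norm_bounded (S.summable_p.hasSum.mul_left _) (fun i => by
      rw [Real.norm_eq_abs]
      exact abs_g_br_sub_le hy i)
  have := ge_of_tendsto' hlim hle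
  rw [← sub_eq_zero, ← abs_eq_zero]
  exact le_antisymm this (abs_nonneg _)

/-- Maximum principle: a Hölder function which is dominated by its image under the transfer
operator is constant. The supremum need not be attained, but it is almost attained in every
cylinder: near-maximality at a point passes to each of its preimages. -/
theorem eq_of_le_tsum_br [Countable ι] [IsFiniteMeasure μ] [NeZero μ] {v : Z → ℝ} {L ρ M : ℝ}
    (h0 : 0 ≤ ρ) (h1 : ρ < 1) (hv : S.HolderFrom 0 L ρ v) (hM : ∀ x, |v x| ≤ M)
    (hle : ∀ x, v x ≤ ∑' i, S.g (S.br i x) * v (S.br i x)) (x y : Z) : v x = v y := by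
  have hne : Nonempty Z := ⟨x⟩
  have hbdd : BddAbove (Set.range v) := ⟨M, by rintro _ ⟨x, rfl⟩; exact (le_abs_self _).trans (hM x)⟩
  set s := ⨆ x, v x
  have hs : ∀ x, v x ≤ s := fun x => le_ciSup hbdd x
  have key : ∀ n z ε, 0 < ε → ∃ w, S.Agree n z w ∧ s - ε < v w := by
    intro n
    induction n with
    | zero =>
      intro z ε hε
      obtain ⟨w, hw⟩ := exists_lt_of_lt_ciSup (show s - ε < ⨆ x, v x by simpa [s] using hε)
      exact ⟨w, by simp [Agree], hw⟩
    | succ n ih =>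
      intro z ε hε
      -- a lower bound for the weights `g` in the cell of `z`
      set c := S.g z / (1 + S.C * S.β) with hc
      have hC := S.C_pos
      have hβ := S.β_pos
      have hc0 : 0 < c := div_pos (S.g_pos z) (by positivity)
      obtain ⟨w, hw, hvw⟩ := ih (S.F z) (c * ε) (by positivity)
      refine ⟨S.br (S.idx z) w, ?_, ?_⟩
      · have := (agree_br (i := S.idx z)).2 hw
        rwa [S.br_F] at this
      set i := S.idx z
      have hci : c ≤ S.g (S.br i w) := by
        have := S.distortion 0 z (S.br i w) (by
          intro k hk
          obtain rfl : k = 0 := by omega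
          simp [S.idx_br, i])
        have := (le_abs_self _).trans this
        rw [hc, div_le_iff₀ (by positivity)]
        simp only [zero_add, pow_one] at this
        linarith
      have hsum : Summable fun i => S.g (S.br i w) * v (S.br i w) := by
        refine Summable.of_norm_bounded ((S.summable_g w).mul_right M) fun i => ?_
        rw [norm_mul, Real.norm_eq_abs, abs_of_pos (S.g_pos _)]
        exact mul_le_mul_of_nonneg_left (hM _) (S.g_pos _).le
      have hsum2 : Summable fun j => S.g (S.br j w) * (s - v (S.br j w)) := by
        simp_rw [mul_sub]
        exact ((S.summable_g w).mul_right s).sub hsum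
      have htot : ∑' j, S.g (S.br j w) * (s - v (S.br j w)) =
          s - ∑' j, S.g (S.br j w) * v (S.br j w) := by
        simp_rw [mul_sub]
        rw [((S.summable_g w).mul_right s).tsum_sub hsum, tsum_mul_right, S.tsum_g_br, one_mul]
      have hterm : S.g (S.br i w) * (s - v (S.br i w)) ≤
          ∑' j, S.g (S.br j w) * (s - v (S.br j w)) :=
        hsum2.le_tsum i fun j _ => mul_nonneg (S.g_pos _).le (sub_nonneg.2 (hs _))
      have h2 : c * (s - v (S.br i w)) < c * ε := by
        have := mul_le_mul_of_nonneg_right hci (sub_nonneg.2 (hs (S.br i w)))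
        have := hle w
        linarith
      have := lt_of_mul_lt_mul_left h2 hc0.le
      linarith
  have heq : ∀ z, v z = s := by
    intro z
    refine le_antisymm (hs z) ?_
    have hlim : Tendsto (fun n : ℕ => v z + (L * ρ ^ n + (1 / 2 : ℝ) ^ n)) atTop (𝓝 (v z)) := by
      have e1 := (tendsto_pow_atTop_nhds_zero_of_lt_one h0 h1).const_mul L
      have e2 := tendsto_pow_atTop_nhds_zero_of_lt_one (r := (1 / 2 : ℝ)) (by norm_num) (by norm_num)
      simpa using (e1.add e2).const_add (v z)
    refine ge_of_tendsto' hlim fun n => ?_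
    obtain ⟨w, hw, hvw⟩ := key n z ((1 / 2 : ℝ) ^ n) (by positivity)
    have := (neg_le_abs _).trans (hv n (Nat.zero_le _) z w hw)
    linarith
  rw [heq x, heq y]

theorem dist_circle (a b : Circle) : dist a b = ‖(a : ℂ) - b‖ :=
  dist_eq_norm (a : ℂ) b

theorem dist_circle_mul_le (a b c d : Circle) : dist (a * b) (c * d) ≤ dist a c + dist b d := by
  simp only [dist_circle, Circle.coe_mul]
  rw [show (a : ℂ) * b - c * d = (a - c) * b + c * (b - d) by ring]
  refine (norm_add_le _ _).trans_eq ?_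
  rw [norm_mul, norm_mul, Circle.norm_coe, Circle.norm_coe, mul_one, one_mul]

theorem exists_circle_eq {z : ℂ} (hz : ‖z‖ = 1) : ∃ c : Circle, (c : ℂ) = z :=
  ⟨⟨z, mem_sphere_zero_iff_norm.2 hz⟩, rfl⟩

/-! ### The twisted transfer operator -/

variable (S) in
/-- The transfer operator of `F` twisted by the circle valued function `W`. -/
def transfer (W : Z → Circle) (v : Z → ℂ) (x : Z) : ℂ :=
  ∑' i, (S.g (S.br i x) : ℂ) * (W (S.br i x) * v (S.br i x))

variable (S) in
/-- `W` is Hölder on each cell, with a constant `a i` on the cell `i` which may be unbounded in `i`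
but is integrable. -/
structure HolderWeight (W : Z → Circle) (a : ι → ℝ) (τ : ℝ) : Prop where
  pos : 0 < τ
  lt_one : τ < 1
  nonneg : ∀ i, 0 ≤ a i
  summable : Summable fun i => S.p i * a i
  holder : ∀ n x y, S.Agree (n + 1) x y → dist (W x) (W y) ≤ a (S.idx x) * τ ^ (n + 1)

theorem norm_g (x : Z) : ‖(S.g x : ℂ)‖ = S.g x := by
  rw [Complex.norm_real, Real.norm_eq_abs, abs_of_pos (S.g_pos x)]

theorem norm_transfer_term_le (W : Z → Circle) {v : Z → ℂ} {M : ℝ} (hv : ∀ x, ‖v x‖ ≤ M) (i : ι)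
    (x : Z) : ‖(S.g (S.br i x) : ℂ) * (W (S.br i x) * v (S.br i x))‖ ≤ S.g (S.br i x) * M := by
  rw [norm_mul, norm_mul, Circle.norm_coe, one_mul, norm_g]
  exact mul_le_mul_of_nonneg_left (hv _) (S.g_pos _).le

theorem summable_transfer (W : Z → Circle) {v : Z → ℂ} {M : ℝ} (hv : ∀ x, ‖v x‖ ≤ M) (x : Z) :
    Summable fun i => (S.g (S.br i x) : ℂ) * (W (S.br i x) * v (S.br i x)) :=
  Summable.of_norm_bounded ((S.summable_g x).mul_right M) fun i => norm_transfer_term_le W hv i x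

theorem norm_transfer_le [Countable ι] [IsFiniteMeasure μ] [NeZero μ]
    (W : Z → Circle) {v : Z → ℂ} {M : ℝ} (hv : ∀ x, ‖v x‖ ≤ M) (x : Z) :
    ‖S.transfer W v x‖ ≤ M := by
  refine tsum_of_norm_bounded ?_ (fun i => norm_transfer_term_le W hv i x)
  have := (S.summable_g x).hasSum.mul_right M
  rwa [S.tsum_g_br, one_mul] at this

theorem transfer_eq_of_forall [Countable ι] [IsFiniteMeasure μ] [NeZero μ]
    {W : Z → Circle} {v : Z → ℂ} {x : Z} {c : ℂ}
    (h : ∀ i, W (S.br i x) * v (S.br i x) = c) : S.transfer W v x = c := by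
  unfold transfer
  simp_rw [h, tsum_mul_right]
  rw [← Complex.ofReal_tsum, S.tsum_g_br, Complex.ofReal_one, one_mul]

/-- The one-step Lasota–Yorke estimate. -/
theorem HolderFrom.transfer [Countable ι] [IsFiniteMeasure μ] [NeZero μ]
    {W : Z → Circle} {a : ι → ℝ} {τ ρ L M : ℝ}
    (hW : S.HolderWeight W a τ) (hβρ : S.β ≤ ρ) (hτρ : τ ≤ ρ)
    {v : Z → ℂ} (hv : ∀ x, ‖v x‖ ≤ M) {k : ℕ} (hH : S.HolderFrom (k + 1) L ρ v) :
    S.HolderFrom k (M * (S.C * ∑' i, S.p i + ∑' i, S.p i * a i) + ρ * L) ρ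
      (S.transfer W v) := by
  intro n hn x y hxy
  have hne : Nonempty Z := ⟨x⟩
  have hM : 0 ≤ M := (norm_nonneg _).trans (hv x)
  have hρ : 0 ≤ ρ := hW.pos.le.trans hτρ
  have hC := S.C_pos
  rw [dist_eq_norm]
  unfold GibbsMarkov.transfer
  rw [← (summable_transfer W hv x).tsum_sub (summable_transfer W hv y)]
  have hsum : HasSum (fun i => (M * (S.C * S.p i + S.p i * a i) + ρ * L * S.g (S.br i y)) * ρ ^ n)
      ((M * (S.C * ∑' i, S.p i + ∑' i, S.p i * a i) + ρ * L) * ρ ^ n) := by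
    have h1 := (S.summable_p.hasSum.mul_left S.C).add hW.summable.hasSum
    have h2 := (S.summable_g y).hasSum.mul_left (ρ * L)
    rw [S.tsum_g_br, mul_one] at h2
    exact ((h1.mul_left M).add h2).mul_right _
  refine tsum_of_norm_bounded hsum fun i => ?_
  have hag : S.Agree (n + 1) (S.br i x) (S.br i y) := agree_br.2 hxy
  set x' := S.br i x
  set y' := S.br i y
  have e : (S.g x' : ℂ) * (W x' * v x') - S.g y' * (W y' * v y') =
      (S.g x' - S.g y' : ℝ) * (W x' * v x') + S.g y' * ((W x' - W y') * v x') +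
        S.g y' * (W y' * (v x' - v y')) := by
    push_cast
    ring
  have b1 : ‖((S.g x' - S.g y' : ℝ) : ℂ) * (W x' * v x')‖ ≤ S.C * S.p i * ρ ^ n * M := by
    rw [norm_mul, norm_mul, Circle.norm_coe, one_mul, Complex.norm_real, Real.norm_eq_abs]
    refine mul_le_mul ((abs_g_br_sub_le hxy i).trans ?_) (hv _) (norm_nonneg _) ?_
    · have := pow_le_pow_left₀ S.β_pos.le hβρ n
      have hp := S.p_nonneg i
      calc S.C * S.β ^ n * S.p i ≤ S.C * ρ ^ n * S.p i := by gcongr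
        _ = _ := by ring
    · have hp := S.p_nonneg i
      positivity
  have b2 : ‖(S.g y' : ℂ) * ((W x' - W y') * v x')‖ ≤ S.p i * a i * ρ ^ n * M := by
    rw [norm_mul, norm_mul, norm_g]
    have h1 : ‖(W x' : ℂ) - W y'‖ ≤ a i * ρ ^ n := by
      have h := hW.holder n x' y' hag
      rw [S.idx_br] at h
      have h2 : τ ^ (n + 1) ≤ ρ ^ n :=
        (pow_le_pow_of_le_one hW.pos.le hW.lt_one.le (Nat.le_succ n)).trans
          (pow_le_pow_left₀ hW.pos.le hτρ n)
      rw [← dist_circle]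
      exact h.trans (mul_le_mul_of_nonneg_left h2 (hW.nonneg i))
    have ha := hW.nonneg i
    have hp := S.p_nonneg i
    calc S.g y' * (‖(W x' : ℂ) - W y'‖ * ‖v x'‖) ≤ S.p i * (a i * ρ ^ n * M) := by
          gcongr
          · exact S.g_br_le i y
          · exact hv _
      _ = _ := by ring
  have b3 : ‖(S.g y' : ℂ) * (W y' * (v x' - v y'))‖ ≤ S.g y' * (L * ρ ^ (n + 1)) := by
    rw [norm_mul, norm_mul, norm_g, Circle.norm_coe, one_mul, ← dist_eq_norm]
    exact mul_le_mul_of_nonneg_left (hH (n + 1) (by omega) _ _ hag) (S.g_pos _).le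
  rw [e]
  refine (norm_add₃_le).trans ((add_le_add (add_le_add b1 b2) b3).trans_eq ?_)
  ring

/-- Starting from a function which depends on the first `n` symbols of the itinerary only, the
`n`-th iterate of the transfer operator is Hölder, with a constant independent of `n`. -/
theorem holderFrom_iterate_transfer [Countable ι] [IsFiniteMeasure μ] [NeZero μ]
    {W : Z → Circle} {a : ι → ℝ} {τ ρ M : ℝ}
    (hW : S.HolderWeight W a τ) (hβρ : S.β ≤ ρ) (hτρ : τ ≤ ρ) (hρ : ρ < 1) (hM : 0 ≤ M)
    {v : Z → ℂ} (hv : ∀ x, ‖v x‖ ≤ M) {n : ℕ} (hn : ∀ x y, S.Agree n x y → v x = v y) (j k : ℕ)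
    (hjk : j + k = n) :
    (∀ x, ‖(S.transfer W)^[j] v x‖ ≤ M) ∧
      S.HolderFrom k (M * (S.C * ∑' i, S.p i + ∑' i, S.p i * a i) / (1 - ρ)) ρ
        ((S.transfer W)^[j] v) := by
  set K := M * (S.C * ∑' i, S.p i + ∑' i, S.p i * a i) with hK
  have hρ0 : 0 ≤ ρ := hW.pos.le.trans hτρ
  have h1ρ : 0 < 1 - ρ := sub_pos.2 hρ
  have hK0 : 0 ≤ K / (1 - ρ) := by
    rcases isEmpty_or_nonempty Z with hZ | hZ
    · exact absurd (Measure.eq_zero_of_isEmpty μ) (NeZero.ne μ)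
    have e1 : 0 ≤ ∑' i, S.p i := tsum_nonneg fun i => S.p_nonneg i
    have e2 : 0 ≤ ∑' i, S.p i * a i := tsum_nonneg fun i => mul_nonneg (S.p_nonneg i) (hW.nonneg i)
    have hC := S.C_pos
    positivity
  induction j generalizing k with
  | zero =>
    refine ⟨hv, fun l hl x y hxy => ?_⟩
    have : v x = v y := hn x y fun i hi => hxy i (by omega)
    simp only [Function.iterate_zero, id_eq, this, dist_self]
    positivity
  | succ j ih =>
    obtain ⟨hb, hH⟩ := ih (k + 1) (by omega)
    rw [Function.iterate_succ_apply']
    refine ⟨norm_transfer_le W hb, ?_⟩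
    have h := HolderFrom.transfer hW hβρ hτρ hb hH
    have e : K + ρ * (K / (1 - ρ)) = K / (1 - ρ) := by
      field_simp
      ring
    rwa [← hK, e] at h

/-! ### Approximation by functions of finitely many symbols -/

theorem generateFrom_le_iSup_comap :
    MeasurableSpace.generateFrom {A : Set Z | ∃ (n : ℕ) (i : ι), A = S.F^[n] ⁻¹' (S.idx ⁻¹' {i})} ≤
      ⨆ n : ℕ, MeasurableSpace.comap (fun x (k : Fin n) => S.idx (S.F^[k] x)) ⊤ := by
  refine MeasurableSpace.generateFrom_le ?_
  rintro _ ⟨n, i, rfl⟩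
  refine (le_iSup (fun n : ℕ => MeasurableSpace.comap
    (fun x (k : Fin n) => S.idx (S.F^[k] x)) ⊤) (n + 1)) _ ?_
  exact ⟨{w | w (Fin.last n) = i}, trivial, rfl⟩

variable (S) in
/-- The filtration whose `n`-th term is generated by the first `n` symbols of the itinerary. -/
def itineraryFiltration [Countable ι] : Filtration ℕ (inferInstance : MeasurableSpace Z) where
  seq n := MeasurableSpace.comap (fun x (k : Fin n) => S.idx (S.F^[k] x)) ⊤
  mono' := by
    rintro n n' hn _ ⟨A, -, rfl⟩
    exact ⟨(fun w (k : Fin n) => w ⟨k, k.2.trans_le hn⟩) ⁻¹' A, trivial, rfl⟩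
  le' := by
    rintro n _ ⟨A, -, rfl⟩
    rw [← Set.biUnion_preimage_singleton]
    exact MeasurableSet.biUnion (Set.to_countable A) fun w _ => measurableSet_agree_itinerary n w

/-- A bounded measurable function is approximated in `L¹` by its conditional expectations given the
first `n` symbols, truncated so that the bound holds at every point. -/
theorem exists_cylinder_approx_real [Countable ι] [IsFiniteMeasure μ]
    {u : Z → ℝ} (hu : Measurable u) (hu1 : ∀ x, |u x| ≤ 1)
    {ε : ENNReal} (hε : 0 < ε) : ∃ N : ℕ, ∀ n ≥ N, ∃ v : Z → ℝ,
      (∀ x y, S.Agree n x y → v x = v y) ∧ (∀ x, |v x| ≤ 1) ∧ ∫⁻ x, ‖v x - u x‖ₑ ∂μ ≤ ε := by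
  set ℱ := S.itineraryFiltration
  have hle : (⨆ n, ℱ n) ≤ (inferInstance : MeasurableSpace Z) := iSup_le ℱ.le
  have hint : Integrable u μ :=
    Integrable.of_bound hu.aestronglyMeasurable 1 (Eventually.of_forall hu1)
  -- `u` agrees with its conditional expectation, since the cylinders generate the `σ`-algebra
  -- modulo null sets
  have hcond : u =ᵐ[μ] μ[u | ⨆ n, ℱ n] := by
    refine Integrable.ae_eq_of_forall_setIntegral_eq _ _ hint integrable_condExp ?_
    intro A hA _
    obtain ⟨A', hA', hAA'⟩ := S.generates A hA
    have hA'' : MeasurableSet[⨆ n, ℱ n] A' := generateFrom_le_iSup_comap _ hA'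
    rw [setIntegral_congr_set hAA', setIntegral_congr_set hAA', setIntegral_condExp hle hint hA'']
  have hlim := tendsto_eLpNorm_condExp (μ := μ) (ℱ := ℱ) u
  obtain ⟨N, hN⟩ := eventually_atTop.1 (hlim.eventually_le_const hε)
  refine ⟨N, fun n hn => ?_⟩
  set E := μ[u | ℱ n]
  have hE : ∀ x y, S.Agree n x y → E x = E y := by
    intro x y hxy
    have hm : Measurable[ℱ n] E := stronglyMeasurable_condExp.measurable
    obtain ⟨A, -, hA⟩ := hm (measurableSet_singleton (E x))
    have hx : x ∈ E ⁻¹' {E x} := rfl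
    rw [← hA] at hx
    have hy : y ∈ E ⁻¹' {E x} := by
      rw [← hA]
      simp only [Set.mem_preimage] at hx ⊢
      rwa [← agree_iff_itinerary_eq.2 hxy]
    exact hy.symm
  refine ⟨fun x => max (-1) (min 1 (E x)), fun x y hxy => by simp only [hE x y hxy], fun x => ?_, ?_⟩
  · exact abs_le.2 ⟨le_max_left _ _, max_le (by norm_num) (min_le_left _ _)⟩
  · have h := hN n hn
    rw [eLpNorm_one_eq_lintegral_enorm] at h
    refine (lintegral_mono_ae ?_).trans h
    filter_upwards [hcond] with x hx
    rw [Pi.sub_apply, ← hx, enorm_le_iff_norm_le, Real.norm_eq_abs, Real.norm_eq_abs]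
    have h1 := abs_le.1 (hu1 x)
    have e1 : u x = max (-1) (min 1 (u x)) := by rw [min_eq_right h1.2, max_eq_right h1.1]
    calc |max (-1) (min 1 (E x)) - u x|
        = |max (-1) (min 1 (E x)) - max (-1) (min 1 (u x))| := by rw [← e1]
      _ ≤ |min 1 (E x) - min 1 (u x)| := by
          simpa using abs_max_sub_max_le_max (-1) (min 1 (E x)) (-1) (min 1 (u x))
      _ ≤ |E x - u x| := by simpa using abs_min_sub_min_le_max 1 (E x) 1 (u x)

theorem exists_cylinder_approx [Countable ι] [IsFiniteMeasure μ]
    {u : Z → ℂ} (hu : Measurable u) (hu1 : ∀ x, ‖u x‖ ≤ 1)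
    {ε : ENNReal} (hε : 0 < ε) : ∃ (n : ℕ) (v : Z → ℂ),
      (∀ x y, S.Agree n x y → v x = v y) ∧ (∀ x, ‖v x‖ ≤ 2) ∧ ∫⁻ x, ‖v x - u x‖ₑ ∂μ ≤ ε := by
  have hε2 : 0 < ε / 2 := ENNReal.half_pos hε.ne'
  obtain ⟨N₁, h1⟩ := exists_cylinder_approx_real (S := S) (Complex.measurable_re.comp hu)
    (fun x => (Complex.abs_re_le_norm _).trans (hu1 x)) hε2
  obtain ⟨N₂, h2⟩ := exists_cylinder_approx_real (S := S) (Complex.measurable_im.comp hu)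
    (fun x => (Complex.abs_im_le_norm _).trans (hu1 x)) hε2
  obtain ⟨v₁, a1, b1, c1⟩ := h1 (max N₁ N₂) (le_max_left _ _)
  obtain ⟨v₂, a2, b2, c2⟩ := h2 (max N₁ N₂) (le_max_right _ _)
  refine ⟨max N₁ N₂, fun x => ⟨v₁ x, v₂ x⟩, fun x y hxy => by
    simp only [a1 x y hxy, a2 x y hxy],
    fun x => ?_, ?_⟩
  · refine (Complex.norm_le_abs_re_add_abs_im _).trans ?_
    linarith [b1 x, b2 x]
  · have hv₂ : Measurable v₂ := by
      have : S.HolderFrom (max N₁ N₂) 0 0 v₂ := by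
        intro n hn x y hxy
        rw [a2 x y fun k hk => hxy k (by omega)]
        simp
      exact this.measurable le_rfl one_pos
    calc ∫⁻ x, ‖(⟨v₁ x, v₂ x⟩ : ℂ) - u x‖ₑ ∂μ
        ≤ ∫⁻ x, (‖v₁ x - (u x).re‖ₑ + ‖v₂ x - (u x).im‖ₑ) ∂μ := by
          refine lintegral_mono fun x => ?_
          have h := Complex.norm_le_abs_re_add_abs_im ((⟨v₁ x, v₂ x⟩ : ℂ) - u x)
          simp only [Complex.sub_re, Complex.sub_im] at h
          rw [← Real.norm_eq_abs, ← Real.norm_eq_abs] at h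
          simp only [← ofReal_norm]
          rw [← ENNReal.ofReal_add (norm_nonneg _) (norm_nonneg _)]
          exact ENNReal.ofReal_le_ofReal h
      _ = ∫⁻ x, ‖v₁ x - (u x).re‖ₑ ∂μ + ∫⁻ x, ‖v₂ x - (u x).im‖ₑ ∂μ :=
          lintegral_add_right _ (hv₂.sub (Complex.measurable_im.comp hu)).enorm
      _ ≤ ε / 2 + ε / 2 := add_le_add c1 c2
      _ = ε := ENNReal.add_halves ε

/-! ### Solutions of the cohomological equation -/

/-- The Hölder constant of a solution of the cohomological equation is controlled by the weight on
a single cell `i`, by iterating the equation along the inverse branch `br i`. -/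
theorem HolderFrom.of_eq_mul {W : Z → Circle} {a : ι → ℝ} {τ ρ L : ℝ} (hW : S.HolderWeight W a τ)
    (hρ0 : 0 ≤ ρ) (hρ : ρ < 1) {u : Z → Circle} (hu : S.HolderFrom 0 L ρ u)
    (huW : ∀ x, u (S.F x) = W x * u x) (i : ι) :
    S.HolderFrom 0 (a i * τ / (1 - τ)) τ u := by
  have hτ : 0 < 1 - τ := sub_pos.2 hW.lt_one
  have key : ∀ m n x y, S.Agree n x y →
      dist (u x) (u y) ≤ a i * τ / (1 - τ) * τ ^ n + L * ρ ^ (n + m) := by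
    intro m
    induction m with
    | zero =>
      intro n x y hxy
      have := hu n (Nat.zero_le _) x y hxy
      have h2 : 0 ≤ a i * τ / (1 - τ) * τ ^ n := by
        have := hW.nonneg i
        have := hW.pos
        positivity
      simpa using this.trans (le_add_of_nonneg_left h2)
    | succ m ih =>
      intro n x y hxy
      have hxy' : S.Agree (n + 1) (S.br i x) (S.br i y) := agree_br.2 hxy
      have h1 := hW.holder n _ _ hxy'
      rw [S.idx_br] at h1
      have h2 := ih (n + 1) _ _ hxy'
      have ex := huW (S.br i x)
      have ey := huW (S.br i y)
      rw [S.F_br] at ex ey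
      rw [ex, ey]
      have h3 := dist_circle_mul_le (W (S.br i x)) (u (S.br i x)) (W (S.br i y)) (u (S.br i y))
      have e : a i * τ ^ (n + 1) + a i * τ / (1 - τ) * τ ^ (n + 1) =
          a i * τ / (1 - τ) * τ ^ n := by
        field_simp
        ring
      rw [show n + (m + 1) = n + 1 + m by ring]
      linarith
  intro n _ x y hxy
  have hlim : Tendsto (fun m : ℕ => a i * τ / (1 - τ) * τ ^ n + L * ρ ^ (n + m)) atTop
      (𝓝 (a i * τ / (1 - τ) * τ ^ n)) := by
    have h1 := (tendsto_pow_atTop_nhds_zero_of_lt_one hρ0 hρ).comp (tendsto_add_atTop_nat n)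
    have h2 := (h1.const_mul L).const_add (a i * τ / (1 - τ) * τ ^ n)
    simpa [Function.comp_def, add_comm n] using h2
  exact ge_of_tendsto' hlim fun m => key m n x y hxy

/-- A nonzero Hölder fixed point of the twisted transfer operator has constant modulus, by the
maximum principle; it is then an average of complex numbers of the same modulus, which must all be
equal. -/
theorem exists_solution_of_transfer_eq [Countable ι] [IsFiniteMeasure μ] [NeZero μ]
    {W : Z → Circle} {u : Z → ℂ} {L ρ : ℝ} (hρ0 : 0 ≤ ρ)
    (hρ : ρ < 1) (hu : S.HolderFrom 0 L ρ u) (hu0 : u ≠ 0) (hfix : S.transfer W u = u) :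
    ∃ (w : Z → Circle) (L' : ℝ), S.HolderFrom 0 L' ρ w ∧ ∀ x, w (S.F x) = W x * w x := by
  obtain ⟨x₀, hx₀⟩ := Function.ne_iff.1 hu0
  have hbd : ∀ x, ‖u x‖ ≤ ‖u x₀‖ + L := by
    intro x
    have h := hu 0 le_rfl x x₀ (by simp [Agree])
    rw [pow_zero, mul_one, dist_eq_norm] at h
    have := norm_sub_norm_le (u x) (u x₀)
    linarith
  have hconst : ∀ x y, ‖u x‖ = ‖u y‖ := by
    refine eq_of_le_tsum_br (S := S) (L := L) (M := ‖u x₀‖ + L) hρ0 hρ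
      (fun n hn x y hxy => ?_) (fun x => ?_) (fun x => ?_)
    · rw [Real.dist_eq]
      exact (abs_norm_sub_norm_le _ _).trans_eq (dist_eq_norm _ _).symm |>.trans (hu n hn x y hxy)
    · rw [abs_norm]
      exact hbd x
    · conv_lhs => rw [← hfix]
      have hs : Summable fun i => S.g (S.br i x) * ‖u (S.br i x)‖ :=
        Summable.of_nonneg_of_le (fun i => mul_nonneg (S.g_pos _).le (norm_nonneg _))
          (fun i => mul_le_mul_of_nonneg_left (hbd _) (S.g_pos _).le)
          ((S.summable_g x).mul_right _)
      refine tsum_of_norm_bounded hs.hasSum fun i => ?_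
      rw [norm_mul, norm_mul, Circle.norm_coe, one_mul, norm_g]
  set c := ‖u x₀‖ with hc
  have hcn : ∀ x, ‖u x‖ = c := fun x => hconst x x₀
  have hc0 : 0 < c := norm_pos_iff.2 hx₀
  have hrel : ∀ x, u (S.F x) = W x * u x := by
    intro x
    set y := S.F x
    -- the defect of the `i`-th branch in the equality case of the triangle inequality
    set d : ι → ℝ := fun i => ‖(W (S.br i y) : ℂ) * u (S.br i y) - u y‖ ^ 2
    have hd : ∀ i, d i = 2 * c ^ 2 -
        2 * (starRingEnd ℂ (u y) * (W (S.br i y) * u (S.br i y))).re := by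
      intro i
      have h1 : ‖(W (S.br i y) : ℂ) * u (S.br i y)‖ = c := by
        rw [norm_mul, Circle.norm_coe, one_mul, hcn]
      simp only [d]
      rw [← Complex.normSq_eq_norm_sq, Complex.normSq_sub, Complex.normSq_eq_norm_sq,
        Complex.normSq_eq_norm_sq, h1, hcn y]
      rw [mul_comm (starRingEnd ℂ (u y)), ← Complex.conj_re]
      simp only [map_mul, Complex.conj_conj, Complex.mul_re, Complex.mul_im, Complex.conj_re,
        Complex.conj_im]
      ring
    have hS := (summable_transfer (S := S) W (M := c) (fun x => (hcn x).le) y).hasSum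
    have hS' : ∑' i, (S.g (S.br i y) : ℂ) * (W (S.br i y) * u (S.br i y)) = u y :=
      congrFun hfix y
    rw [hS'] at hS
    have hS2 := Complex.hasSum_re (hS.mul_left (starRingEnd ℂ (u y)))
    have hnorm : (starRingEnd ℂ (u y) * u y).re = c ^ 2 := by
      rw [mul_comm, Complex.mul_conj, Complex.ofReal_re, Complex.normSq_eq_norm_sq, hcn]
    rw [hnorm] at hS2
    have hg := (S.summable_g y).hasSum.mul_right (2 * c ^ 2)
    rw [S.tsum_g_br, one_mul] at hg
    have hzero : HasSum (fun i => S.g (S.br i y) * d i) 0 := by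
      have h := hg.sub (hS2.mul_left 2)
      rw [sub_self] at h
      refine h.congr_fun ?_
      intro i
      rw [hd, mul_left_comm (starRingEnd ℂ (u y)) (S.g (S.br i y) : ℂ), Complex.re_ofReal_mul]
      ring
    have hall := (hasSum_zero_iff_of_nonneg
      (fun i => mul_nonneg (S.g_pos (S.br i y)).le (sq_nonneg _))).1 hzero
    have h0 := congrFun hall (S.idx x)
    simp only [Pi.zero_apply, mul_eq_zero, (S.g_pos _).ne', false_or] at h0
    have h1 := norm_eq_zero.1 (pow_eq_zero_iff two_ne_zero |>.1 h0)
    rw [S.br_F] at h1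
    exact (sub_eq_zero.1 h1).symm
  have hmem : ∀ x, ∃ w : Circle, (w : ℂ) = u x / c := by
    intro x
    refine exists_circle_eq ?_
    rw [norm_div, hcn, Complex.norm_real, Real.norm_eq_abs, abs_of_pos hc0, div_self hc0.ne']
  choose w hw using hmem
  refine ⟨w, L / c, fun n hn x y hxy => ?_, fun x => ?_⟩
  · rw [dist_circle, hw, hw, ← sub_div, norm_div, Complex.norm_real, Real.norm_eq_abs,
      abs_of_pos hc0, div_mul_eq_mul_div, ← dist_eq_norm]
    exact div_le_div_of_nonneg_right (hu n hn x y hxy) hc0.le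
  · ext
    rw [Circle.coe_mul, hw, hw, hrel, mul_div_assoc]

/-- The twisted transfer operator contracts `L¹`, so its iterates do not increase the distance to a
fixed point. -/
theorem lintegral_iterate_transfer_sub_le [Countable ι] {W : Z → Circle} {u v : Z → ℂ}
    (hu : Measurable u) (hfix : S.transfer W u =ᵐ[μ] u) (hu1 : ∀ x, ‖u x‖ ≤ 1) {M : ℝ}
    (n : ℕ) (hb : ∀ j ≤ n, ∀ x, ‖(S.transfer W)^[j] v x‖ ≤ M)
    (hm : ∀ j ≤ n, Measurable ((S.transfer W)^[j] v)) :
    ∫⁻ x, ‖(S.transfer W)^[n] v x - u x‖ₑ ∂μ ≤ ∫⁻ x, ‖v x - u x‖ₑ ∂μ := by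
  induction n with
  | zero => simp
  | succ n ih =>
    refine le_trans ?_ (ih (fun j hj => hb j (by omega)) fun j hj => hm j (by omega))
    set w := (S.transfer W)^[n] v with hw
    have hwb := hb n (Nat.le_succ n)
    rw [Function.iterate_succ_apply', ← hw]
    calc ∫⁻ x, ‖S.transfer W w x - u x‖ₑ ∂μ
        ≤ ∫⁻ x, ∑' i, ENNReal.ofReal (S.g (S.br i x)) * ‖w (S.br i x) - u (S.br i x)‖ₑ ∂μ := by
          refine lintegral_mono_ae ?_
          filter_upwards [hfix] with x hx
          conv_lhs => rw [← hx]
          unfold GibbsMarkov.transfer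
          rw [← (summable_transfer W hwb x).tsum_sub (summable_transfer W hu1 x)]
          refine (enorm_tsum_le_tsum_enorm).trans (ENNReal.tsum_le_tsum fun i => ?_)
          rw [← mul_sub, ← mul_sub, enorm_mul, enorm_mul]
          have e1 : ‖(S.g (S.br i x) : ℂ)‖ₑ = ENNReal.ofReal (S.g (S.br i x)) := by
            rw [← ofReal_norm, norm_g]
          have e2 : ‖(W (S.br i x) : ℂ)‖ₑ = 1 := by
            rw [← ofReal_norm, Circle.norm_coe, ENNReal.ofReal_one]
          rw [e1, e2, one_mul]
      _ = ∫⁻ x, ‖w x - u x‖ₑ ∂μ :=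
          lintegral_tsum_br (S := S) (((hm n (Nat.le_succ n)).sub hu).enorm)

/-- Regularity of measurable solutions: if the cohomological equation has a measurable solution
almost everywhere, it has a Hölder solution everywhere. The given solution is a fixed point of the
twisted transfer operator, hence a limit of iterates of this operator on functions of finitely many
symbols, which are uniformly Hölder. -/
theorem exists_holder_solution [Countable ι] [IsFiniteMeasure μ] [NeZero μ]
    {W : Z → Circle} {a : ι → ℝ} {τ : ℝ} (hW : S.HolderWeight W a τ)
    {u : Z → Circle} (hu : Measurable fun x => (u x : ℂ))
    (huW : ∀ᵐ x ∂μ, u (S.F x) = W x * u x) :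
    ∃ (w : Z → Circle) (L ρ : ℝ), 0 ≤ ρ ∧ ρ < 1 ∧ S.HolderFrom 0 L ρ w ∧
      ∀ x, w (S.F x) = W x * w x := by
  set ρ := max S.β τ
  have hβρ : S.β ≤ ρ := le_max_left _ _
  have hτρ : τ ≤ ρ := le_max_right _ _
  have hρ0 : 0 ≤ ρ := S.β_pos.le.trans hβρ
  have hρ1 : ρ < 1 := max_lt S.β_lt hW.lt_one
  set U : Z → ℂ := fun x => (u x : ℂ)
  have hU1 : ∀ x, ‖U x‖ ≤ 1 := fun x => (Circle.norm_coe _).le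
  have hfix : S.transfer W U =ᵐ[μ] U := by
    set N := toMeasurable μ {x | ¬ (u (S.F x) = W x * u x)}
    have hN : MeasurableSet N := measurableSet_toMeasurable _ _
    have hN0 : μ N = 0 := by rw [measure_toMeasurable]; exact huW
    have h := lintegral_tsum_br (S := S) (h := N.indicator 1) (measurable_one.indicator hN)
    have hm : Measurable fun x => ∑' i, ENNReal.ofReal (S.g (S.br i x)) *
        N.indicator (1 : Z → ENNReal) (S.br i x) :=
      Measurable.tsum fun i => ((S.measurable_g.comp (S.measurable_br i)).ennreal_ofReal.mul
        ((measurable_one.indicator hN).comp (S.measurable_br i)))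
    rw [lintegral_indicator_one hN, hN0, lintegral_eq_zero_iff hm] at h
    filter_upwards [h] with x hx
    refine transfer_eq_of_forall fun i => ?_
    rw [Pi.zero_apply, ENNReal.tsum_eq_zero] at hx
    have hi := hx i
    have hiN : S.br i x ∉ N := by
      intro hmem
      simp [hmem] at hi
      exact hi.not_gt (S.g_pos _)
    have : u (S.F (S.br i x)) = W (S.br i x) * u (S.br i x) := by
      by_contra hcon
      exact hiN (subset_toMeasurable _ _ hcon)
    rw [S.F_br] at this
    simp only [U]
    rw [this, Circle.coe_mul]
  -- uniformly Hölder approximations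
  set L := 2 * (S.C * ∑' i, S.p i + ∑' i, S.p i * a i) / (1 - ρ)
  have happrox : ∀ k : ℕ, ∃ w : Z → ℂ, (∀ x, ‖w x‖ ≤ 2) ∧ S.HolderFrom 0 L ρ w ∧
      ∫⁻ x, ‖w x - U x‖ₑ ∂μ ≤ (2⁻¹ : ENNReal) ^ k := by
    intro k
    obtain ⟨n, v, hv, hv2, hvu⟩ := exists_cylinder_approx (S := S) hu hU1
      (ε := (2⁻¹ : ENNReal) ^ k) (ENNReal.pow_pos (by simp) k)
    have hit := fun j l hjl => holderFrom_iterate_transfer hW hβρ hτρ hρ1 zero_le_two hv2 hv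
      (n := n) j l hjl
    refine ⟨(S.transfer W)^[n] v, (hit n 0 (by omega)).1, (hit n 0 (by omega)).2, ?_⟩
    refine (lintegral_iterate_transfer_sub_le (M := 2) hu hfix hU1 n
      (fun j hj => (hit j (n - j) (by omega)).1)
      (fun j hj => (hit j (n - j) (by omega)).2.measurable hρ0 hρ1)).trans hvu
  choose w hw2 hwH hwu using happrox
  have hwm : ∀ k, Measurable (w k) := fun k => (hwH k).measurable hρ0 hρ1
  have hdm : ∀ k, Measurable fun x => ‖w k x - U x‖ₑ := fun k => ((hwm k).sub hu).enorm
  have hae : ∀ᵐ x ∂μ, Tendsto (fun k => w k x) atTop (𝓝 (U x)) := by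
    have hsum : ∫⁻ x, ∑' k, ‖w k x - U x‖ₑ ∂μ ≠ ⊤ := by
      rw [lintegral_tsum fun k => (hdm k).aemeasurable]
      refine ne_top_of_le_ne_top ?_ (ENNReal.tsum_le_tsum hwu)
      rw [ENNReal.tsum_geometric]
      simp
    have hlt := ae_lt_top (Measurable.tsum hdm) hsum
    filter_upwards [hlt] with x hx
    have := ENNReal.tendsto_atTop_zero_of_tsum_ne_top hx.ne
    rw [tendsto_iff_edist_tendsto_0]
    simpa [edist_eq_enorm_sub] using this
  -- a pointwise limit along an ultrafilter, defined everywhere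
  have hlim : ∀ x, ∃ c : ℂ, Tendsto (fun k => w k x) (hyperfilter ℕ) (𝓝 c) := by
    intro x
    obtain ⟨c, -, hc⟩ := (isCompact_closedBall (0 : ℂ) 2).ultrafilter_le_nhds
      ((hyperfilter ℕ).map fun k => w k x) (by
        rw [le_principal_iff]
        exact Filter.mem_map.2 (Filter.univ_mem' fun k => by simpa using hw2 k x))
    exact ⟨c, hc⟩
  choose V hV using hlim
  have hVae : ∀ᵐ x ∂μ, V x = U x := by
    filter_upwards [hae] with x hx
    exact tendsto_nhds_unique (hV x) (hx.mono_left Nat.hyperfilter_le_atTop)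
  have hVH : S.HolderFrom 0 L ρ V := fun n hn x y hxy =>
    le_of_tendsto ((hV x).dist (hV y)) (Eventually.of_forall fun k => hwH k n hn x y hxy)
  have hpow : Tendsto (fun n : ℕ => ρ ^ n) atTop (𝓝 0) :=
    tendsto_pow_atTop_nhds_zero_of_lt_one hρ0 hρ1
  have hVnorm : ∀ x, ‖V x‖ = 1 := by
    intro x
    have h1 : ∀ n : ℕ, |‖V x‖ - 1| ≤ L * ρ ^ n := by
      intro n
      obtain ⟨y, hxy, hy⟩ := exists_agree_of_ae hVae n x
      have h := hVH n (Nat.zero_le _) x y hxy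
      have hy1 : ‖V y‖ = 1 := by rw [hy]; exact Circle.norm_coe _
      rw [dist_eq_norm] at h
      rw [← hy1]
      exact (abs_norm_sub_norm_le _ _).trans h
    have h2 := ge_of_tendsto' (by simpa using hpow.const_mul L) h1
    exact sub_eq_zero.1 (abs_eq_zero.1 (le_antisymm h2 (abs_nonneg _)))
  choose w' hw' using fun x => exists_circle_eq (hVnorm x)
  have hH' : S.HolderFrom 0 L ρ w' := fun n hn x y hxy => by
    rw [dist_circle, hw', hw', ← dist_eq_norm]
    exact hVH n hn x y hxy
  refine ⟨w', L, ρ, hρ0, hρ1, hH', fun x => ?_⟩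
  have hgood : ∀ᵐ x ∂μ, w' (S.F x) = W x * w' x := by
    have hV' : ∀ᵐ x ∂μ, w' x = u x := by
      filter_upwards [hVae] with x hx
      exact Circle.ext ((hw' x).trans hx)
    have hVF := S.preserves.quasiMeasurePreserving.ae hV'
    filter_upwards [hV', hVF, huW] with x h1 h2 h3
    rw [h1, h2, h3]
  refine dist_le_zero.1 ?_
  have hbound : ∀ n : ℕ, dist (w' (S.F x)) (W x * w' x) ≤
      L * ρ ^ n + (a (S.idx x) * ρ ^ (n + 1) + L * ρ ^ (n + 1)) := by
    intro n
    obtain ⟨y, hxy, hy⟩ := exists_agree_of_ae hgood (n + 1) x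
    have h1 := hH' n (Nat.zero_le _) _ _ (agree_succ.1 hxy).2
    have h2 := hH' (n + 1) (Nat.zero_le _) x y hxy
    have h3 := (hW.holder n x y hxy).trans (mul_le_mul_of_nonneg_left
      (pow_le_pow_left₀ hW.pos.le hτρ (n + 1)) (hW.nonneg _))
    have h4 := dist_circle_mul_le (W x) (w' x) (W y) (w' y)
    have h5 := dist_triangle_right (w' (S.F x)) (W x * w' x) (w' (S.F y))
    rw [hy] at h5 h1
    linarith
  have hpow' := hpow.comp (tendsto_add_atTop_nat 1)
  have hzero : Tendsto (fun n : ℕ => L * ρ ^ n + (a (S.idx x) * ρ ^ (n + 1) + L * ρ ^ (n + 1)))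
      atTop (𝓝 0) := by
    simpa using (hpow.const_mul L).add ((hpow'.const_mul (a (S.idx x))).add (hpow'.const_mul L))
  exact ge_of_tendsto' hzero hbound

end GibbsMarkov

/-! ### Separation times and itineraries -/

theorem sepPow_le_pow {ρ : ℝ} (h0 : 0 < ρ) (h1 : ρ < 1) {s : ℕ∞} {n : ℕ} (h : (n : ℕ∞) ≤ s) :
    sepPow ρ s ≤ ρ ^ n := by
  unfold sepPow
  split_ifs with hs
  · positivity
  · refine pow_le_pow_of_le_one h0.le h1.le ?_
    rwa [← ENat.natCast_toNat hs, Nat.cast_le] at h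

theorem le_mul_sepPow_iff {ρ a C : ℝ} (h0 : 0 < ρ) (h1 : ρ < 1) (hC : 0 ≤ C) {s : ℕ∞} :
    a ≤ C * sepPow ρ s ↔ ∀ n : ℕ, (n : ℕ∞) ≤ s → a ≤ C * ρ ^ n := by
  constructor
  · exact fun h n hn => h.trans (mul_le_mul_of_nonneg_left (sepPow_le_pow h0 h1 hn) hC)
  · intro h
    unfold sepPow
    split_ifs with hs
    · have hlim := (tendsto_pow_atTop_nhds_zero_of_lt_one h0.le h1).const_mul C
      exact ge_of_tendsto' hlim fun n => h n (hs ▸ le_top)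
    · exact h _ (ENat.natCast_toNat hs).le

namespace TowerMap

variable {X ι : Type*} {D : TowerMap X ι}

theorem natCast_le_baseSep_iff {n : ℕ} {x y : X} (hx : ∀ k, D.baseMap^[k] x ∈ D.base)
    (hy : ∀ k, D.baseMap^[k] y ∈ D.base) :
    (n : ℕ∞) ≤ D.baseSep x y ↔
      ∀ k < n, D.idx (D.baseMap^[k] x) = D.idx (D.baseMap^[k] y) := by
  unfold baseSep
  rw [le_sInf_iff]
  constructor
  · intro h k hk
    by_contra hne
    have := h k ⟨k, rfl, _, _, hne, ⟨rfl, hx k⟩, ⟨rfl, hy k⟩⟩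
    rw [Nat.cast_le] at this
    omega
  · rintro h _ ⟨k, rfl, i, j, hij, h1, h2⟩
    rw [Nat.cast_le]
    by_contra! hk
    exact hij (h1.1.symm.trans ((h k hk).trans h2.1))

theorem mem_cell (x : D.base) : (x : X) ∈ D.cell (D.idx x) 0 := ⟨rfl, x.2⟩

theorem cell_subset_base (i : ι) : D.cell i 0 ⊆ D.base := fun _ hx => hx.2

theorem baseMap_eq {i : ι} {x : X} (hx : x ∈ D.cell i 0) : D.baseMap x = D.T^[D.ret i] x := by
  rw [baseMap, hx.1]

theorem coe_image_subset_cell {i : ι} (A : Set D.base) :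
    ((↑) '' (A ∩ (fun x : D.base => D.idx x) ⁻¹' {i}) : Set X) ⊆ D.cell i 0 := by
  rintro _ ⟨y, ⟨-, rfl⟩, rfl⟩
  exact mem_cell y

variable [MeasurableSpace X] {m : Measure X}

namespace IsYoungTower

/-! ### The return map to the basis -/

theorem baseMap_mem (hD : D.IsYoungTower m) {x : X} (hx : x ∈ D.base) : D.baseMap x ∈ D.base :=
  (hD.bijOn_return (D.idx x)).mapsTo ⟨rfl, hx⟩

theorem iterate_baseMap_mem (hD : D.IsYoungTower m) {x : X} (hx : x ∈ D.base) (k : ℕ) :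
    D.baseMap^[k] x ∈ D.base := by
  induction k with
  | zero => exact hx
  | succ k ih =>
    rw [Function.iterate_succ_apply']
    exact hD.baseMap_mem ih

/-- The return map, as a map of the basis to itself. -/
def returnMap (hD : D.IsYoungTower m) (x : D.base) : D.base := ⟨D.baseMap x, hD.baseMap_mem x.2⟩

theorem coe_iterate_returnMap (hD : D.IsYoungTower m) (x : D.base) (k : ℕ) :
    ((hD.returnMap^[k] x : D.base) : X) = D.baseMap^[k] x := by
  induction k with
  | zero => rfl
  | succ k ih => rw [Function.iterate_succ_apply', Function.iterate_succ_apply', ← ih]; rfl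

theorem exists_branch (hD : D.IsYoungTower m) (i : ι) (x : D.base) :
    ∃ y : D.base, D.idx y = i ∧ hD.returnMap y = x := by
  obtain ⟨y, hy, hyx⟩ := (hD.bijOn_return i).surjOn x.2
  refine ⟨⟨y, hy.2⟩, hy.1, Subtype.ext ?_⟩
  exact (baseMap_eq hy).trans hyx

/-- The inverse branch of the return map with values in the cell `i` of the basis. -/
def branch (hD : D.IsYoungTower m) (i : ι) (x : D.base) : D.base :=
  Classical.choose (hD.exists_branch i x)

theorem idx_branch (hD : D.IsYoungTower m) (i : ι) (x : D.base) : D.idx (hD.branch i x) = i :=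
  (Classical.choose_spec (hD.exists_branch i x)).1

theorem returnMap_branch (hD : D.IsYoungTower m) (i : ι) (x : D.base) :
    hD.returnMap (hD.branch i x) = x :=
  (Classical.choose_spec (hD.exists_branch i x)).2

theorem eq_of_returnMap_eq (hD : D.IsYoungTower m) {x y : D.base} (hi : D.idx x = D.idx y)
    (h : hD.returnMap x = hD.returnMap y) : x = y := by
  refine Subtype.ext ((hD.bijOn_return (D.idx x)).injOn (mem_cell x) ⟨hi.symm, y.2⟩ ?_)
  rw [← baseMap_eq (mem_cell x), ← baseMap_eq (i := D.idx x) ⟨hi.symm, y.2⟩]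
  exact congrArg Subtype.val h

theorem branch_returnMap (hD : D.IsYoungTower m) (x : D.base) :
    hD.branch (D.idx x) (hD.returnMap x) = x :=
  hD.eq_of_returnMap_eq (hD.idx_branch _ _) (hD.returnMap_branch _ _)

theorem natCast_le_baseSep_iff (hD : D.IsYoungTower m) {n : ℕ} {x y : D.base} :
    (n : ℕ∞) ≤ D.baseSep x y ↔
      ∀ k < n, D.idx (hD.returnMap^[k] x : D.base) = D.idx (hD.returnMap^[k] y : D.base) := by
  rw [TowerMap.natCast_le_baseSep_iff (hD.iterate_baseMap_mem x.2) (hD.iterate_baseMap_mem y.2)]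
  simp only [coe_iterate_returnMap]

/-! ### Measurability and images of measurable sets -/

theorem measurableSet_idx (hD : D.IsYoungTower m) (i : ι) : MeasurableSet (D.idx ⁻¹' {i}) := by
  have : D.idx ⁻¹' {i} = ⋃ j, D.cell i j := by
    ext x
    simp [cell]
  rw [this]
  exact MeasurableSet.iUnion fun j => hD.measurableSet_cell i j

theorem measurableSet_base [Countable ι] (hD : D.IsYoungTower m) : MeasurableSet D.base := by
  have : D.base = ⋃ i, D.cell i 0 := by
    ext x
    simp [cell, base]
  rw [this]
  exact MeasurableSet.iUnion fun i => hD.measurableSet_cell i 0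

theorem measurable_baseMap [Countable ι] (hD : D.IsYoungTower m) : Measurable D.baseMap := by
  intro A hA
  have : D.baseMap ⁻¹' A = ⋃ i, D.idx ⁻¹' {i} ∩ D.T^[D.ret i] ⁻¹' A := by
    ext x
    simp [baseMap]
  rw [this]
  exact MeasurableSet.iUnion fun i =>
    (hD.measurableSet_idx i).inter (hD.measurable_T.iterate _ hA)

theorem measurable_returnMap [Countable ι] (hD : D.IsYoungTower m) : Measurable hD.returnMap :=
  (hD.measurable_baseMap.comp measurable_subtype_coe).subtype_mk

theorem image_iterate (hD : D.IsYoungTower m) {i : ι} {A : Set X} (hA : A ⊆ D.cell i 0)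
    (hAm : MeasurableSet A) : ∀ j, j < D.ret i →
      MeasurableSet (D.T^[j] '' A) ∧ m (D.T^[j] '' A) = m A := by
  intro j
  induction j with
  | zero =>
    intro _
    simpa using hAm
  | succ j ih =>
    intro hj
    obtain ⟨h1, h2⟩ := ih (by omega)
    have hsub : D.T^[j] '' A ⊆ D.cell i j :=
      (Set.image_mono hA).trans (hD.bijOn_iterate i j (by omega)).mapsTo.image_subset
    rw [Function.iterate_succ', Set.image_comp]
    exact ⟨(hD.iso_level i j hj).2 _ hsub h1, (hD.measure_level i j hj _ hsub h1).trans h2⟩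

theorem measurableSet_image_return (hD : D.IsYoungTower m) {i : ι} {A : Set X}
    (hA : A ⊆ D.cell i 0) (hAm : MeasurableSet A) : MeasurableSet (D.T^[D.ret i] '' A) := by
  have hr := hD.ret_pos i
  obtain ⟨j, hj⟩ : ∃ j, D.ret i = j + 1 := ⟨D.ret i - 1, by omega⟩
  have h1 := (hD.image_iterate hA hAm j (by omega)).1
  have htop := hD.iso_top i
  have hsub : D.T^[j] '' A ⊆ D.cell i j :=
    (Set.image_mono hA).trans (hD.bijOn_iterate i j (by omega)).mapsTo.image_subset
  rw [hj, Nat.add_sub_cancel] at htop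
  rw [hj, Function.iterate_succ', Set.image_comp]
  exact htop.2 _ hsub h1

theorem coe_image_branch_preimage (hD : D.IsYoungTower m) (i : ι) (A : Set D.base) :
    ((↑) '' (hD.branch i ⁻¹' A) : Set X) =
      D.T^[D.ret i] '' ((↑) '' (A ∩ (fun x : D.base => D.idx x) ⁻¹' {i})) := by
  ext x
  constructor
  · rintro ⟨y, hy, rfl⟩
    refine ⟨_, ⟨hD.branch i y, ⟨hy, hD.idx_branch i y⟩, rfl⟩, ?_⟩
    have h := congrArg Subtype.val (hD.returnMap_branch i y)
    rw [← h]
    exact (baseMap_eq ⟨hD.idx_branch i y, (hD.branch i y).2⟩).symm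
  · rintro ⟨_, ⟨y, ⟨hyA, rfl⟩, rfl⟩, rfl⟩
    refine ⟨hD.returnMap y, ?_, baseMap_eq (mem_cell y)⟩
    rw [Set.mem_preimage, branch_returnMap]
    exact hyA

theorem measurableSet_coe_idx (hD : D.IsYoungTower m) (i : ι) :
    MeasurableSet ((fun x : D.base => D.idx x) ⁻¹' {i}) :=
  measurable_subtype_coe (hD.measurableSet_idx i)

theorem measurable_branch [Countable ι] (hD : D.IsYoungTower m) (i : ι) :
    Measurable (hD.branch i) := by
  intro A hA
  have hB := MeasurableEmbedding.subtype_coe hD.measurableSet_base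
  rw [← hB.measurableSet_image, coe_image_branch_preimage]
  exact hD.measurableSet_image_return (coe_image_subset_cell A)
    (hB.measurableSet_image.2 (hA.inter (hD.measurableSet_coe_idx i)))

/-! ### Invariance of the measure and change of variables -/

/-- The restriction of the measure to the basis. -/
def baseMeasure (_ : D.IsYoungTower m) : Measure D.base := m.comap (↑)

theorem baseMeasure_apply [Countable ι] (hD : D.IsYoungTower m) (A : Set D.base) :
    hD.baseMeasure A = m ((↑) '' A) :=
  comap_subtype_coe_apply hD.measurableSet_base m A

theorem isFiniteMeasure_baseMeasure [Countable ι] [IsFiniteMeasure m] (hD : D.IsYoungTower m) :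
    IsFiniteMeasure hD.baseMeasure :=
  ⟨by rw [baseMeasure_apply]; exact measure_lt_top m _⟩

theorem baseMeasure_ne_zero [Countable ι] [NeZero m] (hD : D.IsYoungTower m) :
    NeZero hD.baseMeasure := by
  refine ⟨fun h => ?_⟩
  have hX : Nonempty X := by
    by_contra hX
    rw [not_nonempty_iff] at hX
    exact NeZero.ne m (Measure.eq_zero_of_isEmpty m)
  obtain ⟨x⟩ := hX
  have h1 := hD.baseMeasure_apply Set.univ
  rw [h, Set.image_univ, Subtype.range_coe] at h1
  have h2 := hD.cell_pos (D.idx x) 0 (hD.ret_pos _)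
  have h3 : m (D.cell (D.idx x) 0) ≤ m D.base := measure_mono (cell_subset_base _)
  rw [← h1] at h3
  exact h2.ne' (le_antisymm h3 bot_le)

/-- The basis is entered from the tops of the columns only, and the mass of a subset of a top is
that of the corresponding subset of the basis. -/
theorem measurePreserving_returnMap [Countable ι] (hD : D.IsYoungTower m) :
    MeasurePreserving hD.returnMap hD.baseMeasure hD.baseMeasure := by
  refine ⟨hD.measurable_returnMap, Measure.ext fun A hA => ?_⟩
  have hB := MeasurableEmbedding.subtype_coe hD.measurableSet_base
  have hA' : MeasurableSet ((↑) '' A : Set X) := hB.measurableSet_image.2 hA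
  rw [Measure.map_apply hD.measurable_returnMap hA, baseMeasure_apply, baseMeasure_apply,
    ← hD.preserves.measure_preimage hA'.nullMeasurableSet]
  set P : ι → Set X := fun i => (↑) '' (hD.returnMap ⁻¹' A ∩ (fun x : D.base => D.idx x) ⁻¹' {i})
    with hP
  have hPsub : ∀ i, P i ⊆ D.cell i 0 := fun i => coe_image_subset_cell _
  have hPm : ∀ i, MeasurableSet (P i) := fun i =>
    hB.measurableSet_image.2 ((hD.measurable_returnMap hA).inter (hD.measurableSet_coe_idx i))
  have e1 : ((↑) '' (hD.returnMap ⁻¹' A) : Set X) = ⋃ i, P i := by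
    rw [← Set.image_iUnion, ← Set.inter_iUnion]
    congr 1
    ext x
    simp
  have hr : ∀ i, D.ret i - 1 < D.ret i := fun i => Nat.sub_lt (hD.ret_pos i) one_pos
  have e2 : D.T ⁻¹' ((↑) '' A) = ⋃ i, D.T^[D.ret i - 1] '' P i := by
    ext x
    simp only [Set.mem_preimage, Set.mem_iUnion]
    constructor
    · rintro ⟨a, ha, hax⟩
      have hlev := hD.level_lt x
      have htop : D.level x = D.ret (D.idx x) - 1 := by
        by_contra hne
        have h := ((hD.iso_level (D.idx x) (D.level x) (by omega)).1.mapsTo ⟨rfl, rfl⟩).2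
        have h2 : D.level (D.T x) = 0 := by rw [← hax]; exact a.2
        omega
      obtain ⟨y, hy, hyx⟩ := (hD.bijOn_iterate (D.idx x) _ (hr _)).surjOn ⟨rfl, htop⟩
      refine ⟨D.idx x, y, ⟨⟨y, hy.2⟩, ⟨?_, hy.1⟩, rfl⟩, hyx⟩
      have : hD.returnMap ⟨y, hy.2⟩ = a := by
        refine Subtype.ext ((baseMap_eq hy).trans ?_)
        have h3 := Function.iterate_succ_apply' D.T (D.ret (D.idx x) - 1) y
        rw [hyx, Nat.succ_eq_add_one, Nat.sub_add_cancel (hD.ret_pos _)] at h3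
        rw [hax, h3]
      rw [Set.mem_preimage, this]
      exact ha
    · rintro ⟨i, _, ⟨y, ⟨hyA, rfl⟩, rfl⟩, rfl⟩
      refine ⟨hD.returnMap y, hyA, ?_⟩
      rw [← Function.iterate_succ_apply' D.T, Nat.succ_eq_add_one,
        Nat.sub_add_cancel (hD.ret_pos _)]
      rfl
  rw [e1, e2, measure_iUnion _ hPm, measure_iUnion _ fun i =>
    (hD.image_iterate (hPsub i) (hPm i) _ (hr i)).1]
  · exact tsum_congr fun i => ((hD.image_iterate (hPsub i) (hPm i) _ (hr i)).2).symm
  · intro i j hij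
    refine Set.disjoint_left.2 ?_
    rintro x ⟨y, hy, hyx⟩ ⟨z, hz, hzx⟩
    have h1 := ((hD.bijOn_iterate i _ (hr i)).mapsTo (hPsub i hy)).1
    have h2 := ((hD.bijOn_iterate j _ (hr j)).mapsTo (hPsub j hz)).1
    rw [hyx] at h1
    rw [hzx] at h2
    exact hij (h1.symm.trans h2)
  · intro i j hij
    exact Set.disjoint_left.2 fun x hx hy => hij ((hPsub i hx).1.symm.trans (hPsub j hy).1)

theorem abs_log_invJac_sub_le (hD : D.IsYoungTower m) : ∃ β : ℝ, 0 < β ∧ β < 1 ∧ ∃ C : ℝ, 0 < C ∧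
    ∀ (n : ℕ) (x y : D.base), (∀ k < n + 1, D.idx (hD.returnMap^[k] x : D.base) =
      D.idx (hD.returnMap^[k] y : D.base)) →
      |Real.log (D.invJac x) - Real.log (D.invJac y)| ≤ C * β ^ (n + 1) := by
  obtain ⟨β, h0, h1, C, hC, h⟩ := hD.distortion
  refine ⟨β, h0, h1, C, hC, fun n x y hxy => ?_⟩
  have hi : D.idx x = D.idx y := hxy 0 (by omega)
  exact (le_mul_sepPow_iff h0 h1 hC.le).1 (h _ x (mem_cell x) y ⟨hi.symm, y.2⟩) _
    (hD.natCast_le_baseSep_iff.2 hxy)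

/-- The measurability of `invJac` is a consequence of the distortion bound. The logarithm is used
because its oscillation on long cylinders is small uniformly in the cell. -/
theorem measurable_invJac [Countable ι] (hD : D.IsYoungTower m) :
    Measurable fun x : D.base => D.invJac x := by
  obtain ⟨β, h0, h1, C, hC, h⟩ := hD.abs_log_invJac_sub_le
  have hlog : Measurable fun x : D.base => Real.log (D.invJac x) := by
    refine measurable_of_countable_fibres (κ := fun n => Fin (n + 1) → ι)
      (fun n x k => D.idx (hD.returnMap^[k] x : D.base))
      (fun n w => measurableSet_itinerary hD.measurable_returnMap hD.measurableSet_coe_idx _ w)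
      (ε := fun n => C * β ^ (n + 1)) ?_ ?_
    · have := (tendsto_pow_atTop_nhds_zero_of_lt_one h0.le h1).comp (tendsto_add_atTop_nat 1)
      simpa using this.const_mul C
    · intro n x y hxy
      rw [Real.dist_eq]
      exact h n x y fun k hk => congrFun hxy ⟨k, hk⟩
  have : (fun x : D.base => D.invJac x) = fun x : D.base => Real.exp (Real.log (D.invJac x)) := by
    ext x
    rw [Real.exp_log (hD.invJac_pos x x.2)]
  rw [this]
  exact Real.measurable_exp.comp hlog

/-- Change of variables along an inverse branch of the return map. -/
theorem lintegral_branch [Countable ι] (hD : D.IsYoungTower m) (i : ι) (h : D.base → ENNReal)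
    (hh : Measurable h) :
    ∫⁻ x, ENNReal.ofReal (D.invJac (hD.branch i x)) * h (hD.branch i x) ∂hD.baseMeasure =
      ∫⁻ x in (fun x : D.base => D.idx x) ⁻¹' {i}, h x ∂hD.baseMeasure := by
  have hB := MeasurableEmbedding.subtype_coe hD.measurableSet_base
  have hci := hD.measurableSet_coe_idx i
  have hJ : Measurable fun x : D.base => ENNReal.ofReal (D.invJac x)⁻¹ :=
    hD.measurable_invJac.inv.ennreal_ofReal
  have hJ' : Measurable fun x : D.base => ENNReal.ofReal (D.invJac x) :=
    hD.measurable_invJac.ennreal_ofReal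
  have key : hD.baseMeasure.map (hD.branch i) =
      (hD.baseMeasure.restrict ((fun x : D.base => D.idx x) ⁻¹' {i})).withDensity
        fun x => ENNReal.ofReal (D.invJac x)⁻¹ := by
    refine Measure.ext fun A hA => ?_
    rw [Measure.map_apply (hD.measurable_branch i) hA, baseMeasure_apply,
      coe_image_branch_preimage, hD.jacobian i _ (coe_image_subset_cell A)
        (hB.measurableSet_image.2 (hA.inter hci)), withDensity_apply _ hA,
      Measure.restrict_restrict hA]
    set E : Set D.base := A ∩ (fun x : D.base => D.idx x) ⁻¹' {i}
    have hE : E = (↑) ⁻¹' ((↑) '' E : Set X) := (Set.preimage_image_eq _ Subtype.val_injective).symm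
    have hsub : ((↑) '' E : Set X) ⊆ D.base := by
      rintro _ ⟨y, -, rfl⟩
      exact y.2
    rw [← Measure.restrict_restrict_of_subset hsub, ← map_comap_subtype_coe hD.measurableSet_base,
      hB.restrict_map, hB.lintegral_map, ← hE]
    rfl
  have h1 := lintegral_map (μ := hD.baseMeasure) (hJ'.mul hh) (hD.measurable_branch i)
  simp only [Pi.mul_apply] at h1
  have h2 := lintegral_withDensity_eq_lintegral_mul
    (hD.baseMeasure.restrict ((fun x : D.base => D.idx x) ⁻¹' {i})) hJ (hJ'.mul hh)
  simp only [Pi.mul_apply] at h2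
  rw [← h1, key, h2]
  refine lintegral_congr fun x => ?_
  have hp := hD.invJac_pos x x.2
  rw [← mul_assoc, ← ENNReal.ofReal_mul (inv_nonneg.2 hp.le), inv_mul_cancel₀ hp.ne',
    ENNReal.ofReal_one, one_mul]

/-- The partition of the tower at time `n`, seen from the basis, is determined by the itinerary
under the return map. -/
theorem measurableSet_generateFrom_itinerary [Countable ι] (hD : D.IsYoungTower m) (i : ι) (j : ℕ)
    (n : ℕ) : MeasurableSet[MeasurableSpace.generateFrom {S : Set D.base | ∃ (n : ℕ) (i : ι),
      S = hD.returnMap^[n] ⁻¹' ((fun x : D.base => D.idx x) ⁻¹' {i})}]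
        {x : D.base | D.T^[n] x ∈ D.cell i j} := by
  set 𝒢 := MeasurableSpace.generateFrom {S : Set D.base | ∃ (n : ℕ) (i : ι),
      S = hD.returnMap^[n] ⁻¹' ((fun x : D.base => D.idx x) ⁻¹' {i})}
  have hF : Measurable[𝒢, 𝒢] hD.returnMap := by
    refine @measurable_generateFrom _ _ 𝒢 _ _ ?_
    rintro _ ⟨n, l, rfl⟩
    exact MeasurableSpace.measurableSet_generateFrom ⟨n + 1, l, rfl⟩
  have hidx : ∀ l, MeasurableSet[𝒢] ((fun x : D.base => D.idx x) ⁻¹' {l}) := fun l =>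
    MeasurableSpace.measurableSet_generateFrom ⟨0, l, rfl⟩
  induction n using Nat.strong_induction_on with
  | _ n ih =>
    have hset : {x : D.base | D.T^[n] x ∈ D.cell i j} = ⋃ l, ((fun x : D.base => D.idx x) ⁻¹' {l} ∩
        {x : D.base | D.T^[n] x ∈ D.cell i j}) := by
      rw [← Set.iUnion_inter]
      ext x
      simp
    rw [hset]
    refine MeasurableSet.iUnion fun l => ?_
    by_cases hn : n < D.ret l
    · by_cases hl : l = i ∧ n = j
      · convert hidx l using 1
        ext x
        simp only [Set.mem_inter_iff, Set.mem_preimage, Set.mem_singleton_iff, Set.mem_ofPred_eq,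
          and_iff_left_iff_imp]
        intro hx
        have := (hD.bijOn_iterate l n hn).mapsTo ⟨hx, x.2⟩
        rwa [← hl.1, ← hl.2]
      · convert MeasurableSet.empty using 1
        rw [Set.eq_empty_iff_forall_notMem]
        rintro x ⟨hx, h1, h2⟩
        have := (hD.bijOn_iterate l n hn).mapsTo ⟨hx, x.2⟩
        exact hl ⟨this.1.symm.trans h1, this.2.symm.trans h2⟩
    · have := hF (ih (n - D.ret l) (Nat.sub_lt_self (hD.ret_pos l) (not_lt.1 hn)))
      convert (hidx l).inter this using 1
      ext x
      simp only [Set.mem_inter_iff, Set.mem_preimage, Set.mem_singleton_iff, Set.mem_ofPred_eq,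
        and_congr_right_iff]
      intro hx
      have e : D.T^[n - D.ret l] (hD.returnMap x : D.base) = D.T^[n] (x : X) := by
        change D.T^[n - D.ret l] (D.baseMap x) = _
        rw [baseMap_eq ⟨hx, x.2⟩, ← Function.iterate_add_apply, Nat.sub_add_cancel (not_lt.1 hn)]
      rw [e]

theorem exists_itinerary_set_ae_eq [Countable ι] (hD : D.IsYoungTower m) (A : Set D.base)
    (hA : MeasurableSet A) : ∃ A' : Set D.base, MeasurableSet[MeasurableSpace.generateFrom
      {S : Set D.base | ∃ (n : ℕ) (i : ι),
        S = hD.returnMap^[n] ⁻¹' ((fun x : D.base => D.idx x) ⁻¹' {i})}] A' ∧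
      A =ᵐ[hD.baseMeasure] A' := by
  have hB := MeasurableEmbedding.subtype_coe hD.measurableSet_base
  obtain ⟨A', hA', hae⟩ := hD.generates ((↑) '' A) (hB.measurableSet_image.2 hA)
  refine ⟨(↑) ⁻¹' A', ?_, ?_⟩
  · have h1 : MeasurableSet[MeasurableSpace.comap ((↑) : D.base → X) (MeasurableSpace.generateFrom
        {S : Set X | ∃ (n : ℕ) (i : ι) (j : ℕ), S = D.T^[n] ⁻¹' D.cell i j})]
        ((↑) ⁻¹' A' : Set D.base) := ⟨A', hA', rfl⟩
    rw [MeasurableSpace.comap_generateFrom] at h1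
    refine MeasurableSpace.generateFrom_le ?_ _ h1
    rintro _ ⟨_, ⟨n, i, j, rfl⟩, rfl⟩
    exact hD.measurableSet_generateFrom_itinerary i j n
  · have h1 : ∀ᵐ x ∂(hD.baseMeasure.map (↑)), (x ∈ ((↑) '' A : Set X) ↔ x ∈ A') := by
      rw [baseMeasure, map_comap_subtype_coe hD.measurableSet_base]
      exact ae_restrict_of_ae hae.mem_iff
    have h2 := (hB.ae_map_iff).1 h1
    filter_upwards [h2] with x hx
    refine propext ?_
    have : ((x : X) ∈ ((↑) '' A : Set X)) ↔ x ∈ A := by simp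
    exact this.symm.trans hx

end IsYoungTower
end TowerMap

/-! ### Elementary estimates -/

theorem abs_sub_le_of_abs_log_sub_le {a b s : ℝ} (ha : 0 < a) (hb : 0 < b)
    (h : |Real.log a - Real.log b| ≤ s) : |a - b| ≤ s * Real.exp s * b := by
  set d := Real.log a - Real.log b with hd
  have hs : 0 ≤ s := (abs_nonneg _).trans h
  have hab : a = b * Real.exp d := by
    rw [hd, Real.exp_sub, Real.exp_log ha, Real.exp_log hb]
    field_simp
  have h2 : |Real.exp d - 1| ≤ s * Real.exp s := by
    obtain ⟨h3, h4⟩ := abs_le.1 h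
    have h5 := Real.add_one_le_exp d
    have h6 : Real.exp d - 1 ≤ s * Real.exp s := by
      have e1 : Real.exp d ≤ Real.exp s := Real.exp_le_exp.2 h4
      have e2 : 1 - s ≤ Real.exp (-s) := Real.one_sub_le_exp_neg s
      have e3 : (1 - s) * Real.exp s ≤ 1 := by
        have := mul_le_mul_of_nonneg_right e2 (Real.exp_pos s).le
        rwa [← Real.exp_add, neg_add_cancel, Real.exp_zero] at this
      linarith
    have h7 : s ≤ s * Real.exp s := le_mul_of_one_le_right hs (Real.one_le_exp hs)
    exact abs_le.2 ⟨by linarith, h6⟩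
  rw [hab, show b * Real.exp d - b = (Real.exp d - 1) * b by ring, abs_mul, abs_of_pos hb]
  exact mul_le_mul_of_nonneg_right h2 hb.le

theorem dist_circle_exp_le (a b : ℝ) : dist (Circle.exp a) (Circle.exp b) ≤ |a - b| := by
  rw [GibbsMarkov.dist_circle, Circle.coe_exp, Circle.coe_exp]
  have h := Real.norm_exp_I_mul_ofReal_sub_one_le (x := a - b)
  have e : Complex.exp (a * Complex.I) - Complex.exp (b * Complex.I) =
      Complex.exp (b * Complex.I) * (Complex.exp (Complex.I * (a - b : ℝ)) - 1) := by
    rw [mul_sub, ← Complex.exp_add, mul_one]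
    push_cast
    ring_nf
  rw [e, norm_mul, Complex.norm_exp_ofReal_mul_I, one_mul]
  exact h

namespace TowerMap

variable {X ι : Type*} {D : TowerMap X ι} [MeasurableSpace X] {m : Measure X}

/-- The function `z ^ φ · e^{i t S_φ f}` on the basis, where `φ` is the return time. -/
def returnWeight (D : TowerMap X ι) (f : X → ℝ) (t : ℝ) (z : Circle) (x : D.base) : Circle :=
  z ^ D.ret (D.idx x) * Circle.exp (t * birkhoffSum D.T f (D.ret (D.idx x)) x)

namespace IsYoungTower

/-! ### The return map as a Gibbs–Markov map -/

theorem exists_gibbsMarkov [Countable ι] [IsProbabilityMeasure m] (hD : D.IsYoungTower m) :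
    ∃ S : GibbsMarkov ι hD.baseMeasure, S.F = hD.returnMap ∧ (S.idx = fun x : D.base => D.idx x) ∧
      S.br = hD.branch ∧ (S.g = fun x : D.base => D.invJac x) ∧
      ∃ K : ℝ, S.p = fun i => K * m.real (D.cell i 0) := by
  obtain ⟨β, hβ0, hβ1, C, hC, hdist⟩ := hD.abs_log_invJac_sub_le
  obtain ⟨K, hK, hKle⟩ := hD.invJac_le
  refine ⟨{ F := hD.returnMap, idx := fun x => D.idx x, br := hD.branch, g := fun x => D.invJac x,
            p := fun i => K * m.real (D.cell i 0), β := β, C := C * Real.exp C,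
            F_br := hD.returnMap_branch, idx_br := hD.idx_branch, br_F := hD.branch_returnMap,
            g_pos := fun x => hD.invJac_pos x x.2, g_le := fun x => hKle _ x (mem_cell x),
            summable_p := hD.summable_cell.mul_left K, β_pos := hβ0, β_lt := hβ1,
            C_pos := mul_pos hC (Real.exp_pos C), distortion := ?_,
            measurable_g := hD.measurable_invJac, measurableSet_idx := hD.measurableSet_coe_idx,
            measurable_br := hD.measurable_branch, preserves := hD.measurePreserving_returnMap,
            lintegral_br := hD.lintegral_branch, generates := hD.exists_itinerary_set_ae_eq },
    rfl, rfl, rfl, rfl, K, rfl⟩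
  intro n x y hxy
  have hy := hD.invJac_pos y y.2
  refine (abs_sub_le_of_abs_log_sub_le (hD.invJac_pos x x.2) hy (hdist n x y hxy)).trans ?_
  have h1 : C * β ^ (n + 1) ≤ C := mul_le_of_le_one_right hC.le (pow_le_one₀ hβ0.le hβ1.le)
  have h2 := Real.exp_le_exp.2 h1
  calc C * β ^ (n + 1) * Real.exp (C * β ^ (n + 1)) * D.invJac y
      ≤ C * β ^ (n + 1) * Real.exp C * D.invJac y := by gcongr
    _ = C * Real.exp C * β ^ (n + 1) * D.invJac y := by ring

/-- The return map to the basis, as a full-branch Gibbs–Markov map. -/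
def gibbsMarkov [Countable ι] [IsProbabilityMeasure m] (hD : D.IsYoungTower m) :
    GibbsMarkov ι hD.baseMeasure := Classical.choose hD.exists_gibbsMarkov

section

variable [Countable ι] [IsProbabilityMeasure m] (hD : D.IsYoungTower m)

theorem gibbsMarkov_F : hD.gibbsMarkov.F = hD.returnMap :=
  (Classical.choose_spec hD.exists_gibbsMarkov).1

theorem gibbsMarkov_idx : hD.gibbsMarkov.idx = fun x : D.base => D.idx x :=
  (Classical.choose_spec hD.exists_gibbsMarkov).2.1

theorem gibbsMarkov_br : hD.gibbsMarkov.br = hD.branch :=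
  (Classical.choose_spec hD.exists_gibbsMarkov).2.2.1

theorem gibbsMarkov_g : hD.gibbsMarkov.g = fun x : D.base => D.invJac x :=
  (Classical.choose_spec hD.exists_gibbsMarkov).2.2.2.1

theorem exists_gibbsMarkov_p : ∃ K : ℝ, hD.gibbsMarkov.p = fun i => K * m.real (D.cell i 0) :=
  (Classical.choose_spec hD.exists_gibbsMarkov).2.2.2.2

theorem gibbsMarkov_agree_iff {n : ℕ} {x y : D.base} :
    hD.gibbsMarkov.Agree n x y ↔ (n : ℕ∞) ≤ D.baseSep x y := by
  rw [natCast_le_baseSep_iff hD, GibbsMarkov.Agree, gibbsMarkov_F, gibbsMarkov_idx]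

theorem gibbsMarkov_holderFrom_zero_iff {E : Type*} [Dist E] {L ρ : ℝ} (h0 : 0 < ρ) (h1 : ρ < 1)
    (hL : 0 ≤ L) {u : D.base → E} : hD.gibbsMarkov.HolderFrom 0 L ρ u ↔
      ∀ x y : D.base, dist (u x) (u y) ≤ L * sepPow ρ (D.baseSep x y) := by
  simp only [GibbsMarkov.HolderFrom, le_mul_sepPow_iff h0 h1 hL, gibbsMarkov_agree_iff, zero_le,
    true_implies]
  exact ⟨fun h x y n hn => h n x y hn, fun h n x y hn => h x y n hn⟩

theorem holderB_of_holderFrom {L ρ : ℝ} (h0 : 0 < ρ) (h1 : ρ < 1) {u : D.base → ℂ}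
    (hu : hD.gibbsMarkov.HolderFrom 0 L ρ u) : D.HolderB ρ u := by
  have hL : L ≤ |L| + 1 := (le_abs_self L).trans (by linarith)
  refine ⟨|L| + 1, by positivity, fun x y => ?_⟩
  simp only [← dist_eq_norm]
  exact (hD.gibbsMarkov_holderFrom_zero_iff h0 h1 (by positivity)).1 (fun n hn x y hxy =>
    (hu n hn x y hxy).trans (mul_le_mul_of_nonneg_right hL (by positivity))) x y

theorem exists_holderFrom_of_holderB {ρ : ℝ} (h0 : 0 < ρ) (h1 : ρ < 1) {u : D.base → ℂ}
    (hu : D.HolderB ρ u) : ∃ L, hD.gibbsMarkov.HolderFrom 0 L ρ u := by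
  obtain ⟨L, hL, h⟩ := hu
  refine ⟨L, (hD.gibbsMarkov_holderFrom_zero_iff h0 h1 hL.le).2 fun x y => ?_⟩
  rw [dist_eq_norm]
  exact h x y

end

/-- Summability of the return times, since the columns have total mass at most one. -/
theorem summable_ret_mul [Countable ι] [IsProbabilityMeasure m] (hD : D.IsYoungTower m) :
    Summable fun i => m.real (D.cell i 0) * D.ret i := by
  have hcell : ∀ i j, j < D.ret i → m (D.cell i j) = m (D.cell i 0) := by
    intro i j hj
    have := (hD.image_iterate le_rfl (hD.measurableSet_cell i 0) j hj).2
    rwa [(hD.bijOn_iterate i j hj).image_eq] at this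
  have hcol : ∀ i, m (D.cell i 0) * D.ret i ≤ m (D.idx ⁻¹' {i}) := by
    intro i
    have hdisj : (↑(Finset.range (D.ret i)) : Set ℕ).PairwiseDisjoint (D.cell i) :=
      fun j _ k _ hjk => Set.disjoint_left.2 fun x hx hy => hjk (hx.2.symm.trans hy.2)
    have h := measure_biUnion_finset (μ := m) hdisj fun j _ => hD.measurableSet_cell i j
    rw [Finset.sum_congr rfl fun j hj => hcell i j (Finset.mem_range.1 hj), Finset.sum_const,
      Finset.card_range, nsmul_eq_mul, mul_comm] at h
    rw [← h]
    refine measure_mono (Set.iUnion₂_subset fun j _ x hx => hx.1)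
  have hle : ∑' i, m (D.cell i 0) * D.ret i ≤ m Set.univ := by
    refine (ENNReal.tsum_le_tsum hcol).trans ((tsum_meas_le_meas_iUnion_of_disjoint m
      hD.measurableSet_idx ?_).trans (measure_mono (Set.subset_univ _)))
    intro i j hij
    exact Set.disjoint_left.2 fun x hx hy => hij (hx.symm.trans hy)
  have h := ENNReal.summable_toReal (ne_top_of_le_ne_top (measure_ne_top m _) hle)
  simpa [Measure.real] using h

/-! ### The twisted weight -/

theorem nextBase_iterate (hD : D.IsYoungTower m) {x : X} (hx : x ∈ D.base) {k : ℕ}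
    (hk : k < D.ret (D.idx x)) : D.nextBase (D.T^[k] x) = D.baseMap x := by
  obtain ⟨h1, h2⟩ := (hD.bijOn_iterate _ k hk).mapsTo ⟨rfl, hx⟩
  rw [nextBase, h1, h2, ← Function.iterate_add_apply, Nat.sub_add_cancel hk.le]
  rfl

/-- Birkhoff sums up to the return time are Hölder on each cell of the basis, with a constant
proportional to the return time. -/
theorem abs_birkhoffSum_sub_le (hD : D.IsYoungTower m) {τ C : ℝ} (h0 : 0 < τ) (h1 : τ < 1)
    (hC : 0 ≤ C) {f : X → ℝ} (hf : ∀ x y, ‖f x - f y‖ ≤ C * sepPow τ (D.sep x y)) {n : ℕ}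
    {x y : D.base} (hi : D.idx x = D.idx y)
    (hn : (n : ℕ∞) ≤ D.baseSep (D.baseMap x) (D.baseMap y)) :
    |birkhoffSum D.T f (D.ret (D.idx x)) x - birkhoffSum D.T f (D.ret (D.idx x)) y| ≤
      C * D.ret (D.idx x) * τ ^ (n + 1) := by
  rw [birkhoffSum, birkhoffSum, ← Finset.sum_sub_distrib]
  refine (Finset.abs_sum_le_sum_abs _ _).trans ?_
  refine (Finset.sum_le_card_nsmul _ _ (C * τ ^ (n + 1)) fun k hk => ?_).trans_eq ?_
  · rw [Finset.mem_range] at hk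
    refine (hf _ _).trans (mul_le_mul_of_nonneg_left (sepPow_le_pow h0 h1 ?_) hC)
    have hx := (hD.bijOn_iterate _ k hk).mapsTo (mem_cell x)
    have hy := (hD.bijOn_iterate _ k hk).mapsTo
      (show (y : X) ∈ D.cell (D.idx x) 0 from ⟨hi.symm, y.2⟩)
    rw [sep, if_pos ⟨hx.1.trans hy.1.symm, hx.2.trans hy.2.symm⟩, hD.nextBase_iterate x.2 hk,
      hD.nextBase_iterate y.2 (hi ▸ hk)]
    push_cast
    gcongr
  · rw [Finset.card_range, nsmul_eq_mul]
    ring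

theorem holderWeight_returnWeight [Countable ι] [IsProbabilityMeasure m] (hD : D.IsYoungTower m)
    {τ C : ℝ} (h0 : 0 < τ) (h1 : τ < 1) (hC : 0 ≤ C) {f : X → ℝ}
    (hf : ∀ x y, ‖f x - f y‖ ≤ C * sepPow τ (D.sep x y)) (t : ℝ) (z : Circle) :
    hD.gibbsMarkov.HolderWeight (D.returnWeight f t z) (fun i => |t| * C * D.ret i) τ where
  pos := h0
  lt_one := h1
  nonneg i := by positivity
  summable := by
    obtain ⟨K, hK⟩ := hD.exists_gibbsMarkov_p
    rw [hK]
    refine (hD.summable_ret_mul.mul_left (K * (|t| * C))).congr fun i => ?_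
    ring
  holder n x y hxy := by
    have h := (GibbsMarkov.agree_succ.1 hxy)
    rw [gibbsMarkov_F, gibbsMarkov_agree_iff] at h
    rw [gibbsMarkov_idx] at h ⊢
    have hi : D.idx x = D.idx y := h.1
    have hb := hD.abs_birkhoffSum_sub_le h0 h1 hC hf hi h.2
    have hm := GibbsMarkov.dist_circle_mul_le (z ^ D.ret (D.idx x))
      (Circle.exp (t * birkhoffSum D.T f (D.ret (D.idx x)) x)) (z ^ D.ret (D.idx x))
      (Circle.exp (t * birkhoffSum D.T f (D.ret (D.idx x)) y))
    rw [dist_self, zero_add] at hm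
    unfold returnWeight
    rw [← hi]
    refine hm.trans ((dist_circle_exp_le _ _).trans ?_)
    rw [← mul_sub, abs_mul]
    calc |t| * |birkhoffSum D.T f (D.ret (D.idx x)) x - birkhoffSum D.T f (D.ret (D.idx x)) y|
        ≤ |t| * (C * D.ret (D.idx x) * τ ^ (n + 1)) := by gcongr
      _ = |t| * C * D.ret (D.idx x) * τ ^ (n + 1) := by ring

/-- The points of the basis which return at `x` are its images under the inverse branches. -/
theorem branch_mem_firstReturn (hD : D.IsYoungTower m) (i : ι) (x : D.base) :
    hD.branch i x ∈ D.firstReturn (D.ret i) x := by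
  have hc : (hD.branch i x : X) ∈ D.cell i 0 := ⟨hD.idx_branch i x, (hD.branch i x).2⟩
  refine ⟨hD.ret_pos i, ?_, fun k hk hkr hmem => ?_⟩
  · rw [← baseMap_eq hc]
    exact congrArg Subtype.val (hD.returnMap_branch i x)
  · have h1 := ((hD.bijOn_iterate i k hkr).mapsTo hc).2
    have h2 : D.level (D.T^[k] (hD.branch i x)) = 0 := hmem
    omega

/-- The first return operator `R(z,t)` is the twisted transfer operator of the return map. -/
theorem opR_eq_transfer [Countable ι] [IsProbabilityMeasure m] (hD : D.IsYoungTower m)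
    (f : X → ℝ) (t : ℝ) (z : Circle) {u : D.base → ℂ} {M : ℝ} (hu : ∀ x, ‖u x‖ ≤ M) (x : D.base) :
    D.opR f z t u x = hD.gibbsMarkov.transfer (D.returnWeight f t z) u x := by
  let e : ι ≃ (n : ℕ) × D.firstReturn n x :=
    { toFun := fun i => ⟨D.ret i, hD.branch i x, hD.branch_mem_firstReturn i x⟩
      invFun := fun p => D.idx (p.2 : D.base)
      left_inv := fun i => hD.idx_branch i x
      right_inv := by
        rintro ⟨n, y, hy⟩
        obtain rfl := hD.eq_ret hy
        have hxy : hD.returnMap y = x := Subtype.ext hy.2.1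
        have : hD.branch (D.idx y) x = y := by rw [← hxy, branch_returnMap]
        simp only
        congr }
  set F : ((n : ℕ) × D.firstReturn n x) → ℂ := fun p => z ^ p.1 * D.weight f t u p.1 p.2 with hF
  have hterm : ∀ i, F (e i) = (hD.gibbsMarkov.g (hD.gibbsMarkov.br i x) : ℂ) *
      (D.returnWeight f t z (hD.gibbsMarkov.br i x) * u (hD.gibbsMarkov.br i x)) := by
    intro i
    rw [gibbsMarkov_g, gibbsMarkov_br]
    simp only [hF, e, Equiv.coe_fn_mk, weight, returnWeight, hD.idx_branch, Circle.coe_mul,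
      Circle.coe_pow, Circle.coe_exp, Complex.ofReal_mul]
    rw [show Complex.I * t * (birkhoffSum D.T f (D.ret i) (hD.branch i x) : ℝ) =
      t * (birkhoffSum D.T f (D.ret i) (hD.branch i x) : ℝ) * Complex.I by ring]
    ring
  have hsum : Summable F := by
    rw [← e.summable_iff]
    refine (GibbsMarkov.summable_transfer (S := hD.gibbsMarkov) (D.returnWeight f t z) hu
      x).congr fun i => (hterm i).symm
  have h1 : D.opR f z t u x = ∑' p, F p := by
    rw [hsum.tsum_sigma]
    refine tsum_congr fun n => ?_
    rw [opRn, ← tsum_mul_left]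
  rw [h1, ← e.tsum_eq F]
  exact tsum_congr hterm

/-! ### Cohomology and the return map -/

/-- A measurable solution on the whole tower restricts to a solution on the basis. -/
theorem ae_solution_of_isCohomologousTo [Countable ι] (hD : D.IsYoungTower m) {f : X → ℝ} {t : ℝ}
    {z : Circle} (h : IsCohomologousTo m D.T f t z⁻¹) :
    ∃ u : D.base → Circle, (Measurable fun x => (u x : ℂ)) ∧
      ∀ᵐ x ∂hD.baseMeasure, u (hD.returnMap x) = D.returnWeight f t z x * u x := by
  obtain ⟨ω, hω, hae⟩ := h
  refine ⟨fun x => ω x, hω.comp measurable_subtype_coe, ?_⟩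
  have hB := MeasurableEmbedding.subtype_coe hD.measurableSet_base
  have h1 : ∀ᵐ x ∂m, ∀ n : ℕ, Circle.exp (t * f (D.T^[n] x)) =
      z⁻¹ * (ω (D.T (D.T^[n] x)) / ω (D.T^[n] x)) :=
    ae_all_iff.2 fun n => (hD.preserves.iterate n).quasiMeasurePreserving.ae hae
  have h2 : ∀ᵐ x ∂m, ∀ n : ℕ, ω (D.T^[n] x) =
      z ^ n * Circle.exp (t * birkhoffSum D.T f n x) * ω x := by
    filter_upwards [h1] with x hx n
    induction n with
    | zero => simp [birkhoffSum]
    | succ n ih =>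
      have h3 : ω (D.T (D.T^[n] x)) = z * Circle.exp (t * f (D.T^[n] x)) * ω (D.T^[n] x) := by
        rw [hx n, mul_inv_cancel_left, div_mul_cancel]
      rw [Function.iterate_succ_apply', h3, ih, birkhoffSum_succ, mul_add, Circle.exp_add, pow_succ]
      simp only [mul_assoc, mul_comm, mul_left_comm]
  have h3 := ae_restrict_of_ae (s := D.base) h2
  rw [← map_comap_subtype_coe hD.measurableSet_base] at h3
  filter_upwards [(hB.ae_map_iff).1 h3] with x hx
  exact hx (D.ret (D.idx x))

theorem nextBase_mem (hD : D.IsYoungTower m) (x : X) : D.nextBase x ∈ D.base := by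
  have hl := hD.level_lt x
  obtain ⟨y, hy, hyx⟩ := (hD.bijOn_iterate (D.idx x) _ hl).surjOn ⟨rfl, rfl⟩
  have h := hD.nextBase_iterate hy.2 (k := D.level x) (by rw [hy.1]; exact hl)
  rw [hyx] at h
  rw [h]
  exact hD.baseMap_mem hy.2

theorem measurable_nextBase [Countable ι] (hD : D.IsYoungTower m) : Measurable D.nextBase := by
  intro A hA
  have : D.nextBase ⁻¹' A = ⋃ i, ⋃ j, D.cell i j ∩ D.T^[D.ret i - j] ⁻¹' A := by
    ext x
    simp only [Set.mem_preimage, nextBase, Set.mem_iUnion, Set.mem_inter_iff, cell,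
      Set.mem_ofPred_eq]
    constructor
    · exact fun h => ⟨_, _, ⟨rfl, rfl⟩, h⟩
    · rintro ⟨i, j, ⟨rfl, rfl⟩, h⟩
      exact h
  rw [this]
  exact MeasurableSet.iUnion fun i => MeasurableSet.iUnion fun j =>
    (hD.measurableSet_cell i j).inter (hD.measurable_T.iterate _ hA)

/-- A Hölder function on the tower is determined, up to a small error, by the cell of the point and
finitely many symbols of the itinerary of its next iterate in the basis. -/
theorem measurable_of_holderX [Countable ι] [IsProbabilityMeasure m] (hD : D.IsYoungTower m)
    {τ : ℝ} (h0 : 0 < τ) (h1 : τ < 1) {f : X → ℝ} (hf : D.HolderX τ f) : Measurable f := by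
  obtain ⟨C, hC, hf⟩ := hf
  have hnm := hD.measurable_nextBase
  have hnext := hD.nextBase_mem
  refine measurable_of_countable_fibres (κ := fun n => (ι × ℕ) × (Fin n → ι))
    (fun n x => ((D.idx x, D.level x), fun k => D.idx (D.baseMap^[k] (D.nextBase x))))
    (fun n w => ?_) (ε := fun n => C * τ ^ n) ?_ ?_
  · have h := hnm (measurableSet_itinerary hD.measurable_baseMap hD.measurableSet_idx n w.2)
    convert (hD.measurableSet_cell w.1.1 w.1.2).inter h using 1
    ext x
    simp [cell, Prod.ext_iff]
  · simpa using (tendsto_pow_atTop_nhds_zero_of_lt_one h0.le h1).const_mul C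
  · intro n x y hxy
    simp only [Prod.mk.injEq] at hxy
    rw [Real.dist_eq]
    refine (hf x y).trans (mul_le_mul_of_nonneg_left (sepPow_le_pow h0 h1 ?_) hC.le)
    rw [sep, if_pos hxy.1]
    refine le_trans ?_ le_self_add
    exact (TowerMap.natCast_le_baseSep_iff (hD.iterate_baseMap_mem (hnext x))
      (hD.iterate_baseMap_mem (hnext y))).2 fun k hk => congrFun hxy.2 ⟨k, hk⟩

end IsYoungTower
end TowerMap

/-! ### Eigenvalues and solutions on the tower -/

theorem measurable_inv_mul_cexp {X : Type*} [MeasurableSpace X] {b : X → ℝ} (hb : Measurable b)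
    (w : ℂ) : Measurable fun x => (w * Complex.exp ((b x : ℝ) * Complex.I))⁻¹ := by
  fun_prop

namespace TowerMap

variable {X ι : Type*} {D : TowerMap X ι} [MeasurableSpace X] {m : Measure X}

namespace IsYoungTower

/-- A solution on the basis extends to the whole tower: its value at `x` is determined by its value
at the next point of the orbit of `x` in the basis. -/
theorem isCohomologousTo_of_solution [Countable ι] [IsProbabilityMeasure m]
    (hD : D.IsYoungTower m) {f : X → ℝ} (hf : Measurable f) {t : ℝ} {z : Circle}
    {u : D.base → Circle} (hu : Measurable fun x => (u x : ℂ))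
    (h : ∀ x, u (hD.returnMap x) = D.returnWeight f t z x * u x) :
    IsCohomologousTo m D.T f t z⁻¹ := by
  set k : X → ℕ := fun x => D.ret (D.idx x) - D.level x
  set ω : X → Circle := fun x =>
    (z ^ k x * Circle.exp (t * birkhoffSum D.T f (k x) x))⁻¹ * u ⟨D.nextBase x, hD.nextBase_mem x⟩
    with hω
  refine ⟨ω, ?_, ae_of_all _ fun x => ?_⟩
  · have hk : Measurable k := by
      refine measurable_to_countable' fun n => ?_
      have : k ⁻¹' {n} = ⋃ i, ⋃ j, ⋃ _ : D.ret i - j = n, D.cell i j := by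
        ext x
        simp [k, cell]
      rw [this]
      exact MeasurableSet.iUnion fun i => MeasurableSet.iUnion fun j =>
        MeasurableSet.iUnion fun _ => hD.measurableSet_cell i j
    have hG : Measurable fun p : X × ℕ =>
        ((z : ℂ) ^ p.2 * Complex.exp ((t * birkhoffSum D.T f p.2 p.1 : ℝ) * Complex.I))⁻¹ := by
      refine measurable_from_prod_countable_left fun n => ?_
      dsimp only
      have hb : Measurable fun x => t * birkhoffSum D.T f n x :=
        (Finset.measurable_fun_sum _ fun j _ => hf.comp (hD.measurable_T.iterate j)).const_mul t
      exact measurable_inv_mul_cexp hb _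
    have hU : Measurable fun x => (u ⟨D.nextBase x, hD.nextBase_mem x⟩ : ℂ) :=
      hu.comp hD.measurable_nextBase.subtype_mk
    have := (hG.comp (measurable_id.prodMk hk)).mul hU
    convert this using 1
    ext x
    simp only [hω, Circle.coe_mul, Circle.coe_inv, Circle.coe_pow, Circle.coe_exp, Pi.mul_apply,
      Function.comp_apply, id_eq]
  · have hl := hD.level_lt x
    have hstep : ω (D.T x) = z * Circle.exp (t * f x) * ω x := by
      have hkx : k x = D.ret (D.idx x) - D.level x - 1 + 1 := by simp only [k]; omega
      have hsum := birkhoffSum_succ' D.T f (D.ret (D.idx x) - D.level x - 1) x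
      by_cases hlt : D.level x + 1 < D.ret (D.idx x)
      · obtain ⟨h1, h2⟩ := (hD.iso_level _ _ hlt).1.mapsTo ⟨rfl, rfl⟩
        have hkT : k (D.T x) = D.ret (D.idx x) - D.level x - 1 := by simp only [k, h1, h2]; omega
        have hn : D.nextBase (D.T x) = D.nextBase x := by
          change D.T^[k (D.T x)] (D.T x) = D.T^[k x] x
          rw [hkT, hkx, Function.iterate_succ_apply]
        simp only [hω, hn]
        rw [hkT, hkx, hsum, mul_add, Circle.exp_add, pow_succ']
        rw [mul_mul_mul_comm z (z ^ _), mul_inv (z * _), mul_assoc (z * _)⁻¹, mul_inv_cancel_left]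
      · have htop : D.level x = D.ret (D.idx x) - 1 := by omega
        have hTx : D.T x ∈ D.base := (hD.iso_top _).1.mapsTo ⟨rfl, htop⟩
        have hkx1 : k x = 1 := by simp only [k]; omega
        have hn : D.nextBase x = D.T x := by
          change D.T^[k x] x = _
          rw [hkx1, Function.iterate_one]
        have hlev : D.level (D.T x) = 0 := hTx
        have hkT : k (D.T x) = D.ret (D.idx (D.T x)) := by simp only [k, hlev, Nat.sub_zero]
        have hnT : (⟨D.nextBase (D.T x), hD.nextBase_mem _⟩ : D.base) =
            hD.returnMap ⟨D.T x, hTx⟩ := by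
          refine Subtype.ext ?_
          change D.T^[k (D.T x)] (D.T x) = D.baseMap (D.T x)
          rw [hkT, baseMap]
        have e1 : ω (D.T x) = u ⟨D.T x, hTx⟩ := by
          simp only [hω]
          rw [hnT, h, hkT]
          exact inv_mul_cancel_left _ _
        rw [e1]
        simp only [hω, hn]
        rw [hkx1, birkhoffSum_one, pow_one, mul_inv_cancel_left]
    rw [hstep, mul_div_cancel_right, inv_mul_cancel_left]

/-- The Hölder constants of the solutions are bounded uniformly in `z`, and locally uniformly in
`t`. -/
theorem exists_uniform_holder [Countable ι] [IsProbabilityMeasure m] (hD : D.IsYoungTower m)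
    {τ : ℝ} (h0 : 0 < τ) (h1 : τ < 1) {f : X → ℝ} (hf : D.HolderX τ f) :
    ∃ A : ℝ, ∀ (t : ℝ) (z : Circle) (u : D.base → Circle) (L ρ : ℝ), 0 ≤ ρ → ρ < 1 →
      hD.gibbsMarkov.HolderFrom 0 L ρ u →
      (∀ x, u (hD.returnMap x) = D.returnWeight f t z x * u x) →
      hD.gibbsMarkov.HolderFrom 0 (|t| * A) τ u := by
  obtain ⟨C, hC, hf⟩ := hf
  have hX : Nonempty X := nonempty_of_isProbabilityMeasure m
  set i := D.idx (Classical.arbitrary X)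
  refine ⟨C * D.ret i * τ / (1 - τ), fun t z u L ρ hρ0 hρ1 hu h => ?_⟩
  have hW := hD.holderWeight_returnWeight h0 h1 hC.le hf t z
  have := hu.of_eq_mul hW hρ0 hρ1 (by rw [gibbsMarkov_F]; exact h) i
  convert this using 1
  ring

/-- A cohomological equation which has a measurable solution has a Hölder solution on the basis. -/
theorem exists_solution_of_isCohomologousTo [Countable ι] [IsProbabilityMeasure m]
    (hD : D.IsYoungTower m) {τ : ℝ} (h0 : 0 < τ) (h1 : τ < 1) {f : X → ℝ} (hf : D.HolderX τ f)
    {t : ℝ} {z : Circle} (h : IsCohomologousTo m D.T f t z⁻¹) :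
    ∃ (u : D.base → Circle) (L ρ : ℝ), 0 ≤ ρ ∧ ρ < 1 ∧ hD.gibbsMarkov.HolderFrom 0 L ρ u ∧
      ∀ x, u (hD.returnMap x) = D.returnWeight f t z x * u x := by
  have := hD.isFiniteMeasure_baseMeasure
  have := hD.baseMeasure_ne_zero
  obtain ⟨C, hC, hf⟩ := hf
  obtain ⟨u, hu, huW⟩ := hD.ae_solution_of_isCohomologousTo h
  have h2 := GibbsMarkov.exists_holder_solution
    (hD.holderWeight_returnWeight h0 h1 hC.le hf t z) hu (by rw [gibbsMarkov_F]; exact huW)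
  rwa [gibbsMarkov_F] at h2

theorem isCohomologousTo_of_holder_solution [Countable ι] [IsProbabilityMeasure m]
    (hD : D.IsYoungTower m) {τ : ℝ} (h0 : 0 < τ) (h1 : τ < 1) {f : X → ℝ} (hf : D.HolderX τ f)
    {t : ℝ} {z : Circle} {u : D.base → Circle} {L ρ : ℝ} (hρ0 : 0 ≤ ρ) (hρ1 : ρ < 1)
    (hu : hD.gibbsMarkov.HolderFrom 0 L ρ u)
    (h : ∀ x, u (hD.returnMap x) = D.returnWeight f t z x * u x) :
    IsCohomologousTo m D.T f t z⁻¹ := by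
  have hu' : hD.gibbsMarkov.HolderFrom 0 L ρ fun x => (u x : ℂ) := hu
  exact hD.isCohomologousTo_of_solution (hD.measurable_of_holderX h0 h1 hf)
    (hu'.measurable hρ0 hρ1) h

theorem isCohomologousTo_inv_iff_hasEigenvalueOne [Countable ι] [IsProbabilityMeasure m]
    (hD : D.IsYoungTower m) {τ : ℝ} (h0 : 0 < τ) (h1 : τ < 1) {f : X → ℝ} (hf : D.HolderX τ f)
    {ν : ℝ} (hτν : τ ≤ ν) (hν : ν < 1) (t : ℝ) (z : Circle) :
    IsCohomologousTo m D.T f t z⁻¹ ↔ D.HasEigenvalueOne f ν z t := by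
  have := hD.isFiniteMeasure_baseMeasure
  have := hD.baseMeasure_ne_zero
  have hν0 : 0 < ν := h0.trans_le hτν
  constructor
  · intro h
    obtain ⟨u, L, ρ, hρ0, hρ1, hu, huW⟩ := hD.exists_solution_of_isCohomologousTo h0 h1 hf h
    obtain ⟨A, hA⟩ := hD.exists_uniform_holder h0 h1 hf
    have hu2 := hA t z u L ρ hρ0 hρ1 hu huW
    refine ⟨fun x => u x, hD.holderB_of_holderFrom hν0 hν (L := |(|t| * A)|)
      (fun n hn x y hxy => ?_), fun hzero => ?_, funext fun x => ?_⟩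
    · refine (hu2 n hn x y hxy).trans ?_
      have := pow_le_pow_left₀ h0.le hτν n
      calc |t| * A * τ ^ n ≤ |(|t| * A)| * τ ^ n := by
            gcongr
            exact le_abs_self _
        _ ≤ |(|t| * A)| * ν ^ n := by gcongr
    · have hX : Nonempty X := nonempty_of_isProbabilityMeasure m
      exact Circle.coe_ne_zero _ (congrFun hzero ⟨_, hD.nextBase_mem (Classical.arbitrary X)⟩)
    · rw [hD.opR_eq_transfer f t z (M := 1) (fun x => (Circle.norm_coe _).le)]
      refine GibbsMarkov.transfer_eq_of_forall fun i => ?_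
      have h3 := huW (hD.branch i x)
      rw [returnMap_branch] at h3
      rw [gibbsMarkov_br, h3, Circle.coe_mul]
  · rintro ⟨u, hu, hu0, hfix⟩
    obtain ⟨L, hL⟩ := hD.exists_holderFrom_of_holderB hν0 hν hu
    have hbdd : ∃ M, ∀ x, ‖u x‖ ≤ M := by
      obtain ⟨x₀, -⟩ := Function.ne_iff.1 hu0
      refine ⟨‖u x₀‖ + L, fun x => ?_⟩
      have h2 := hL 0 le_rfl x x₀ (fun k hk => absurd hk (Nat.not_lt_zero k))
      rw [pow_zero, mul_one, dist_eq_norm] at h2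
      have := norm_sub_norm_le (u x) (u x₀)
      linarith
    obtain ⟨M, hM⟩ := hbdd
    have hfix' : hD.gibbsMarkov.transfer (D.returnWeight f t z) u = u := by
      rw [← hfix]
      refine funext fun x => ?_
      rw [hfix, ← hD.opR_eq_transfer f t z hM, hfix]
    obtain ⟨w, L', hw, hrel⟩ := GibbsMarkov.exists_solution_of_transfer_eq hν0.le hν hL hu0 hfix'
    rw [gibbsMarkov_F] at hrel
    exact hD.isCohomologousTo_of_holder_solution h0 h1 hf hν0.le hν hw hrel

/-! ### Constants cohomologous to the exponentials -/

/-- If `1` is cohomologous to a constant, the transfer function is constant on the basis, so that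
the constant is a root of unity whose order divides all return times. -/
theorem eq_one_of_isCohomologousTo_zero [Countable ι] [IsProbabilityMeasure m]
    (hD : D.IsYoungTower m) (hmix : D.IsMixing) {τ : ℝ} (h0 : 0 < τ) (h1 : τ < 1) {f : X → ℝ}
    (hf : D.HolderX τ f) {c : Circle} (h : IsCohomologousTo m D.T f 0 c) : c = 1 := by
  rw [← inv_inv c] at h
  obtain ⟨u, L, ρ, hρ0, hρ1, hu, huW⟩ := hD.exists_solution_of_isCohomologousTo h0 h1 hf h
  obtain ⟨A, hA⟩ := hD.exists_uniform_holder h0 h1 hf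
  have hu2 := hA 0 c⁻¹ u L ρ hρ0 hρ1 hu huW
  have hconst : ∀ x y, u x = u y := fun x y => by
    have := hu2 0 le_rfl x y (fun k hk => absurd hk (Nat.not_lt_zero k))
    rw [abs_zero, zero_mul, zero_mul] at this
    exact dist_le_zero.1 this
  have hX : Nonempty X := nonempty_of_isProbabilityMeasure m
  have hpow : ∀ i, c⁻¹ ^ D.ret i = 1 := by
    intro i
    have h2 := huW (hD.branch i ⟨_, hD.nextBase_mem (Classical.arbitrary X)⟩)
    rw [hconst _ (hD.branch i ⟨_, hD.nextBase_mem (Classical.arbitrary X)⟩), returnWeight,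
      hD.idx_branch, zero_mul, Circle.exp_zero, mul_one] at h2
    exact right_eq_mul.1 h2
  have h2 := hmix (orderOf c⁻¹) fun i => orderOf_dvd_of_pow_eq_one (hpow i)
  exact inv_eq_one.1 (orderOf_eq_one_iff.1 h2)

end IsYoungTower
end TowerMap

/-! ### Group structure -/

namespace IsCohomologousTo

variable {X : Type*} [MeasurableSpace X] {m : Measure X} {T : X → X} {f : X → ℝ}

theorem zero : IsCohomologousTo m T f 0 1 :=
  ⟨fun _ => 1, measurable_const, ae_of_all _ fun x => by simp⟩

theorem add {s t : ℝ} {c d : Circle} (hs : IsCohomologousTo m T f s c)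
    (ht : IsCohomologousTo m T f t d) : IsCohomologousTo m T f (s + t) (c * d) := by
  obtain ⟨ω, hω, h⟩ := hs
  obtain ⟨ω', hω', h'⟩ := ht
  refine ⟨fun x => ω x * ω' x, by simpa [Pi.mul_def] using hω.mul hω', ?_⟩
  filter_upwards [h, h'] with x hx hx'
  rw [add_mul, Circle.exp_add, hx, hx', mul_mul_mul_comm, mul_div_mul_comm]

theorem neg {t : ℝ} {c : Circle} (ht : IsCohomologousTo m T f t c) :
    IsCohomologousTo m T f (-t) c⁻¹ := by
  obtain ⟨ω, hω, h⟩ := ht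
  refine ⟨fun x => (ω x)⁻¹, by simpa [Pi.inv_def] using hω.inv, ?_⟩
  filter_upwards [h] with x hx
  rw [neg_mul, Circle.exp_neg, hx, mul_inv, inv_div_inv, inv_div]

end IsCohomologousTo

namespace TowerMap

variable {X ι : Type*} {D : TowerMap X ι} [MeasurableSpace X] {m : Measure X}

namespace IsYoungTower

theorem isCohomologousTo_unique [Countable ι] [IsProbabilityMeasure m]
    (hD : D.IsYoungTower m) (hmix : D.IsMixing) {τ : ℝ} (h0 : 0 < τ) (h1 : τ < 1) {f : X → ℝ}
    (hf : D.HolderX τ f) {t : ℝ} {c d : Circle} (hc : IsCohomologousTo m D.T f t c)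
    (hd : IsCohomologousTo m D.T f t d) : c = d := by
  have h := hc.add hd.neg
  rw [add_neg_cancel] at h
  exact mul_inv_eq_one.1 (hD.eq_one_of_isCohomologousTo_zero hmix h0 h1 hf h)

/-- Being cohomologous to a constant passes to the limit, both in the parameter and in the
constant: the solutions on the basis are locally uniformly Hölder, so they have limits along
ultrafilters, which are solutions. -/
theorem isCohomologousTo_of_tendsto [Countable ι] [IsProbabilityMeasure m]
    (hD : D.IsYoungTower m) {τ : ℝ} (h0 : 0 < τ) (h1 : τ < 1) {f : X → ℝ} (hf : D.HolderX τ f)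
    {α : Type*} {U : Ultrafilter α} {s : α → ℝ} {ζ : α → Circle} {t : ℝ} {c : Circle}
    (hs : Tendsto s U (𝓝 t)) (hζ : Tendsto ζ U (𝓝 c))
    (h : ∀ᶠ a in U, IsCohomologousTo m D.T f (s a) (ζ a)) : IsCohomologousTo m D.T f t c := by
  obtain ⟨A, hA⟩ := hD.exists_uniform_holder h0 h1 hf
  have hex : ∀ a, ∃ u : D.base → Circle, IsCohomologousTo m D.T f (s a) (ζ a) →
      hD.gibbsMarkov.HolderFrom 0 (|s a| * A) τ u ∧
      ∀ x, u (hD.returnMap x) = D.returnWeight f (s a) (ζ a)⁻¹ x * u x := by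
    intro a
    by_cases ha : IsCohomologousTo m D.T f (s a) (ζ a)
    · rw [← inv_inv (ζ a)] at ha
      obtain ⟨u, L, ρ, hρ0, hρ1, hu, huW⟩ := hD.exists_solution_of_isCohomologousTo h0 h1 hf ha
      exact ⟨u, fun _ => ⟨hA _ _ u L ρ hρ0 hρ1 hu huW, huW⟩⟩
    · exact ⟨fun _ => 1, fun h => absurd h ha⟩
  choose u hu using hex
  set V : D.base → Circle := fun x => (U.map fun a => u a x).lim
  have hV : ∀ x, Tendsto (fun a => u a x) U (𝓝 (V x)) :=
    fun x => (U.map fun a => u a x).le_nhds_lim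
  have hVH : hD.gibbsMarkov.HolderFrom 0 (|t| * A) τ V := by
    intro n hn x y hxy
    have hr : Tendsto (fun a => |s a| * A * τ ^ n) U (𝓝 (|t| * A * τ ^ n)) :=
      (hs.abs.mul_const A).mul_const _
    refine le_of_tendsto_of_tendsto ((hV x).dist (hV y)) hr ?_
    filter_upwards [h] with a ha
    exact (hu a ha).1 n hn x y hxy
  have hVW : ∀ x, V (hD.returnMap x) = D.returnWeight f t c⁻¹ x * V x := by
    intro x
    have hw : Tendsto (fun a => D.returnWeight f (s a) (ζ a)⁻¹ x) U
        (𝓝 (D.returnWeight f t c⁻¹ x)) :=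
      (hζ.inv.pow _).mul ((Circle.exp.continuous.tendsto _).comp (hs.mul_const _))
    refine tendsto_nhds_unique (hV _) ((hw.mul (hV x)).congr' ?_)
    filter_upwards [h] with a ha
    exact ((hu a ha).2 x).symm
  have := hD.isCohomologousTo_of_holder_solution h0 h1 hf h0.le h1 hVH hVW
  rwa [inv_inv] at this

end IsYoungTower
end TowerMap

end
theorem proposition5p1 {X ι : Type*} [MeasurableSpace X] [Countable ι]
    (m : MeasureTheory.Measure X) [MeasureTheory.IsProbabilityMeasure m]
    (D : TowerMap X ι) (hD : D.IsYoungTower m) (hmix : D.IsMixing)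
    (τ : ℝ) (hτ0 : 0 < τ) (hτ1 : τ < 1) (f : X → ℝ) (hf : D.HolderX τ f) :
    (∀ η : ℝ, 0 < η → η < 1 / 2 → ∀ (t : ℝ) (z : Circle),
      IsCohomologousTo m D.T f t z⁻¹ ↔ D.HasEigenvalueOne f (τ ^ η) (z : ℂ) t) ∧
    ∃ 𝔄 : AddSubgroup ℝ,
      (𝔄 : Set ℝ) = {t : ℝ | ∃ c : Circle, IsCohomologousTo m D.T f t c} ∧
      IsClosed (𝔄 : Set ℝ) ∧
      (∀ t ∈ 𝔄, ∃! c : Circle, IsCohomologousTo m D.T f t c) ∧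
      ∃ ζ : 𝔄 → Circle, (∀ t : 𝔄, IsCohomologousTo m D.T f t (ζ t)) ∧
        (∀ s t : 𝔄, ζ (s + t) = ζ s * ζ t) ∧ Continuous ζ := by
  refine ⟨fun η h0 h1 t z => ?_, ?_⟩
  · refine hD.isCohomologousTo_inv_iff_hasEigenvalueOne hτ0 hτ1 hf ?_
      (Real.rpow_lt_one hτ0.le hτ1 h0) t z
    have := Real.rpow_le_rpow_of_exponent_ge hτ0 hτ1.le (show η ≤ 1 by linarith)
    rwa [Real.rpow_one] at this
  let 𝔄 : AddSubgroup ℝ :=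
    { carrier := {t : ℝ | ∃ c : Circle, IsCohomologousTo m D.T f t c}
      zero_mem' := ⟨1, .zero⟩
      add_mem' := fun ⟨c, hc⟩ ⟨d, hd⟩ => ⟨c * d, hc.add hd⟩
      neg_mem' := fun ⟨c, hc⟩ => ⟨c⁻¹, hc.neg⟩ }
  have hex : ∀ t : 𝔄, ∃ c : Circle, IsCohomologousTo m D.T f t c := fun t => t.2
  choose ζ hζ using hex
  refine ⟨𝔄, rfl, ?_, ?_, ζ, hζ, fun s t => ?_, ?_⟩
  · rw [isClosed_iff_ultrafilter]
    intro t U hU hmem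
    have hsel : ∀ s : ℝ, ∃ c : Circle, s ∈ 𝔄 → IsCohomologousTo m D.T f s c := by
      intro s
      by_cases hs : s ∈ 𝔄
      · exact ⟨ζ ⟨s, hs⟩, fun _ => hζ ⟨s, hs⟩⟩
      · exact ⟨1, fun h => absurd h hs⟩
    choose ξ hξ using hsel
    exact ⟨(U.map ξ).lim, hD.isCohomologousTo_of_tendsto hτ0 hτ1 hf (s := id) (ζ := ξ) hU
      (U.map ξ).le_nhds_lim (Filter.mem_of_superset hmem hξ)⟩
  · rintro t ⟨c, hc⟩
    exact ⟨c, hc, fun d hd => hD.isCohomologousTo_unique hmix hτ0 hτ1 hf hd hc⟩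
  · exact hD.isCohomologousTo_unique hmix hτ0 hτ1 hf (hζ (s + t)) ((hζ s).add (hζ t))
  · rw [continuous_iff_ultrafilter]
    intro t U hU
    have hlim : Filter.Tendsto ζ U (nhds (U.map ζ).lim) := (U.map ζ).le_nhds_lim
    have hs : Filter.Tendsto (fun a : 𝔄 => (a : ℝ)) U (nhds (t : ℝ)) :=
      (continuous_subtype_val.tendsto t).mono_left hU
    have h := hD.isCohomologousTo_of_tendsto hτ0 hτ1 hf hs hlim (Filter.Eventually.of_forall hζ)
    rwa [hD.isCohomologousTo_unique hmix hτ0 hτ1 hf (hζ t) h]
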